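/- **Setting.** Let $G$ be a finite group. Let $\Sigma=(V,E,F)$ be a 2-dimensional CW complex with finitely many oriented edges, whose plaquettes $f\in F$ are glued along closed edge paths $\partial f$. Let $Y\subseteq V$ be a non-empty set of ghost vertices, and suppose that every connected component of $\Sigma$ contains a ghost vertex (this holds in particular if $\Sigma$ is connected). For $\mathbf g\in G^E$ and an edge path $w=q_1^{a_1}\cdots q_m^{a_m}$ ($a_i=\pm1$) let $\mathbf g_w=g_{q_1}^{a_1}\cdots g_{q_m}^{a_m}$ be the holonomy. On $\mathbb C[G^E]$ with basis $|\mathbf g\rangle$, the check $X_v^h$ ($v\in V\setminus Y$, $h\in G$) multiplies by $h$ from the left on all edges starting at $v$ and by $h^{-1}$ from the right on all edges ending at $v$, and the check $Z_f$ ($f\in F$) is $|\mathbf g\rangle\mapsto\mathbb I(\mathbf g_{\partial f}=1)|\mathbf g\rangle$. The codespace $\mathcal C$ of the rough quantum double is the space of all states fixed by all $X_v^h$ with $v\notin Y$, $h\in G$ and all $Z_f$. Let $\Sigma/Y$ be the complex in which all ghost vertices are identified with one point, and let $\pi=\pi_1(\Sigma/Y,Y)$, i.e. closed edge paths at $Y$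 modulo backtracking and boundaries of plaquettes, multiplied by concatenation (first factor first). For $\phi\in\mathrm{Hom}(\pi,G)$ let $|\phi\rangle$ be the sum of all $|\mathbf g\rangle$ such that $\mathbf g_p=\phi([p])$ for every closed edge path $p$ of $\Sigma/Y$ based at $Y$. **Proposition.** There is a disjoint union of trees $T'\subseteq E$ covering all vertices of $\Sigma$, each tree containing exactly one ghost vertex. For every such $T'$ and every choice of edge paths $\sigma_v$ in $T'$ from each vertex $v$ to a ghost vertex, let $\mathcal G=E\setminus T'$, and for $q\in\mathcal G$ let $\gamma_q$ be the loop of $\Sigma/Y$ that runs from $Y$ backwards along $\sigma_v$ to the initial vertex $v$ of $q$, then along $q$, then along $\sigma_u$ from the terminal vertex $u$ of $q$ to $Y$. Then: 1. $\pi$ is presented by the generators $\mathcal G$, with $q\mapsto[\gamma_q]$, and by one relation for every plaquette $f$, namely the word $\partial f$ with the edges of $T'$ deleted. 2. The states $|\phi\rangle$, $\phi\in\mathrm{Hom}(\pi,G)$, form a basis of $\mathcal C$. 3. For $\phi\in\mathrm{Hom}(\pi,G)$ and $q\in\mathcal G$, the operator $$Z^{\mathrm L}_{\phi,\gamma_q}|\mathbf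 g\rangle=\mathbb I\big(\mathbf g_{\gamma_q}=\phi([\gamma_q])\big)|\mathbf g\rangle$$ commutes with all checks. These operators are a complete set of $Z$-logicals: the unital algebra generated by their restrictions to $\mathcal C$ is the set of all restrictions to $\mathcal C$ of operators that are diagonal in the basis $|\mathbf g\rangle$ and map $\mathcal C$ into itself. 4. For $\phi_1,\phi_2\in\mathrm{Hom}(\pi,G)$, the operator $$X^{\mathrm L}_{\phi_2\phi_1}=\prod_{q\in\mathcal G}\overrightarrow X_q^{\left(\phi_2([\gamma_q])\phi_1([\gamma_q])^{-1}\right)^{\mathbf g_{\sigma(q)}}}Z^{\mathrm L}_{\phi_1,\gamma_q}$$ commutes with all checks. Here $\overrightarrow X_q^{h}$ is left multiplication by $h$ on the edge $q$, $h^k:=khk^{-1}$, and $\sigma(q)=\sigma_v$ for the initial vertex $v$ of $q$ (the one whose $X$-check acts on $q$ by left multiplication); in each factor $Z^{\mathrm L}_{\phi_1,\gamma_q}$ is applied first, and the factors of different $q$ commute. Moreover $X^{\mathrm L}_{\phi_2\phi_1}|\phi_1\rangle=|\phi_2\rangle$, and $X^{\mathrm L}_{\phi_2\phi_1}|\phi\rangle=0$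 for $\phi\neq\phi_1$. The operators $X^{\mathrm L}_{\phi_2\phi_1}$ are a complete set of logical operators: their restrictions to $\mathcal C$ form a basis of the space of all linear operators on $\mathcal C$. -/

import Mathlib

namespace QuantumDouble

/-! ### Oriented graphs, walks, two-dimensional complexes -/

/-- An oriented (multi)graph with vertex set `V` and edge set `E`; loops and multiple edges are
allowed. -/
structure OrientedGraph (V E : Type*) where
  src : E → V
  tgt : E → V

/-- A word in signed edges; `(e, true)` traverses `e` along its orientation and `(e, false)`
traverses it backwards. -/
abbrev EdgeWord (E : Type*) := List (E × Bool)

/-- The same path run backwards. -/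
def EdgeWord.reverse {E : Type*} (w : EdgeWord E) : EdgeWord E :=
  (w.map fun x => (x.1, !x.2)).reverse

namespace OrientedGraph

variable {V E : Type*} (Γ : OrientedGraph V E)

/-- The vertex at which the signed edge `x` starts. -/
def start (x : E × Bool) : V := if x.2 then Γ.src x.1 else Γ.tgt x.1

/-- The vertex at which the signed edge `x` finishes. -/
def finish (x : E × Bool) : V := if x.2 then Γ.tgt x.1 else Γ.src x.1

/-- `Γ.IsWalk u w v`: the word `w` is an edge path from `u` to `v`. -/
def IsWalk : V → EdgeWord E → V → Prop
  | u, [], v => u = v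
  | u, x :: w, v => Γ.start x = u ∧ IsWalk (Γ.finish x) w v

/-- The image of a graph under a map of the vertices (the edges are kept). -/
def map {V' : Type*} (q : V → V') : OrientedGraph V' E where
  src e := q (Γ.src e)
  tgt e := q (Γ.tgt e)

variable {Γ}

theorem IsWalk.append {u v z : V} {w w' : EdgeWord E} (h : Γ.IsWalk u w v)
    (h' : Γ.IsWalk v w' z) : Γ.IsWalk u (w ++ w') z := by
  induction w generalizing u with
  | nil => cases h; exact h'
  | cons x w ih => exact ⟨h.1, ih h.2⟩

theorem IsWalk.reverse {u v : V} {w : EdgeWord E} (h : Γ.IsWalk u w v) :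
    Γ.IsWalk v w.reverse u := by
  induction w generalizing u with
  | nil => cases h; rfl
  | cons x w ih =>
    have h1 : Γ.IsWalk (Γ.finish x) [(x.1, !x.2)] u := by
      obtain ⟨e, b⟩ := x
      have := h.1
      cases b <;> simp_all [IsWalk, start, finish]
    have := (ih h.2).append h1
    simpa [EdgeWord.reverse] using this

theorem IsWalk.map {V' : Type*} (q : V → V') {u v : V} {w : EdgeWord E} (h : Γ.IsWalk u w v) :
    (Γ.map q).IsWalk (q u) w (q v) := by
  induction w generalizing u with
  | nil => cases h; rfl
  | cons x w ih =>
    refine ⟨?_, ?_⟩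
    · rw [← h.1]; unfold start; split <;> rfl
    · have : (Γ.map q).finish x = q (Γ.finish x) := by unfold finish; split <;> rfl
      rw [this]; exact ih h.2

end OrientedGraph

/-- A two-dimensional CW complex with vertices `V`, oriented edges `E` and plaquettes `F`; the
plaquette `f` is glued along the closed edge path `bdry f`, which starts and ends at `base f`
(a plaquette glued to a single vertex has `bdry f = []`). -/
structure TwoComplex (V E F : Type*) extends OrientedGraph V E where
  base : F → V
  bdry : F → EdgeWord E
  bdry_closed : ∀ f, toOrientedGraph.IsWalk (base f) (bdry f) (base f)

namespace TwoComplex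

variable {V E F : Type*}

/-! ### The fundamental group -/

/-- Closed edge paths based at `v`. -/
@[ext] structure Loop (K : TwoComplex V E F) (v : V) where
  word : EdgeWord E
  isWalk : K.IsWalk v word v

instance (K : TwoComplex V E F) (v : V) : Monoid (K.Loop v) where
  mul p q := ⟨p.word ++ q.word, p.isWalk.append q.isWalk⟩
  one := ⟨[], rfl⟩
  mul_assoc _ _ _ := Loop.ext (List.append_assoc _ _ _)
  one_mul _ := Loop.ext (List.nil_append _)
  mul_one _ := Loop.ext (List.append_nil _)

/-- Elementary homotopies of closed edge paths: `q` arises from `p` by the insertion of a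
backtracking `x x⁻¹`, or by the insertion of the boundary of a plaquette. -/
def ElemHomotopy (K : TwoComplex V E F) (v : V) (p q : K.Loop v) : Prop :=
  ∃ a b : EdgeWord E, p.word = a ++ b ∧
    ((∃ x : E × Bool, q.word = a ++ [x, (x.1, !x.2)] ++ b) ∨ ∃ f : F, q.word = a ++ K.bdry f ++ b)

/-- Homotopy of closed edge paths: the congruence generated by the elementary homotopies. -/
def homotopy (K : TwoComplex V E F) (v : V) : Con (K.Loop v) := conGen (K.ElemHomotopy v)

/-- The fundamental group of the complex with base point `v`: closed edge paths up to homotopy,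
multiplied by concatenation (first factor first). -/
def FundamentalGroup (K : TwoComplex V E F) (v : V) := (K.homotopy v).Quotient

instance (K : TwoComplex V E F) (v : V) : Monoid (K.FundamentalGroup v) :=
  inferInstanceAs (Monoid (K.homotopy v).Quotient)

/-- The homotopy class of a closed edge path. -/
def homotopyClass (K : TwoComplex V E F) {v : V} : K.Loop v →* K.FundamentalGroup v :=
  (K.homotopy v).mk'

theorem homotopyClass_mul_reverse (K : TwoComplex V E F) {v : V} (p : K.Loop v) :
    K.homotopyClass p * K.homotopyClass ⟨p.word.reverse, p.isWalk.reverse⟩ = 1 := by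
  have key : ∀ (w a : EdgeWord E) (u : V), K.IsWalk v a u → ∀ h : K.IsWalk u w v,
      ∀ (h1 : K.IsWalk v (a ++ w ++ (w.reverse ++ a.reverse)) v)
        (h2 : K.IsWalk v (a ++ a.reverse) v),
      K.homotopyClass ⟨_, h1⟩ = K.homotopyClass ⟨_, h2⟩ := by
    intro w
    induction w with
    | nil =>
      intro a u ha h h1 h2
      congr 1
      apply Loop.ext
      simp [EdgeWord.reverse]
    | cons x w ih =>
      intro a u ha h h1 h2
      have hx : K.IsWalk u [x] (K.finish x) := ⟨h.1, rfl⟩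
      have hax := ha.append hx
      have e1 := ih (a ++ [x]) _ hax h.2
        (((hax.append h.2)).append (h.2.reverse.append hax.reverse))
        (hax.append hax.reverse)
      have e2 : K.homotopyClass ⟨a ++ a.reverse, h2⟩ =
          K.homotopyClass ⟨(a ++ [x]) ++ EdgeWord.reverse (a ++ [x]), hax.append hax.reverse⟩ := by
        apply Quotient.sound
        apply ConGen.Rel.of
        refine ⟨a, a.reverse, rfl, Or.inl ⟨x, ?_⟩⟩
        simp [EdgeWord.reverse]
      rw [e2, ← e1]
      congr 1
      apply Loop.ext
      simp [EdgeWord.reverse]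
  have h0 : K.IsWalk v ([] : EdgeWord E) v := rfl
  have := key p.word [] v h0 p.isWalk
    (by simpa [EdgeWord.reverse] using p.isWalk.append p.isWalk.reverse) rfl
  calc _ = K.homotopyClass (p * ⟨p.word.reverse, p.isWalk.reverse⟩) := (map_mul _ _ _).symm
    _ = _ := by
      refine Eq.trans ?_ this
      congr 1
      apply Loop.ext
      change p.word ++ p.word.reverse = _
      simp [EdgeWord.reverse]
    _ = K.homotopyClass 1 := rfl
    _ = 1 := map_one _

noncomputable instance (K : TwoComplex V E F) (v : V) : Group (K.FundamentalGroup v) :=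
  groupOfIsUnit fun a => by
    induction a using Con.induction_on with
    | H p =>
      have h1 := K.homotopyClass_mul_reverse p
      have h2 := K.homotopyClass_mul_reverse ⟨p.word.reverse, p.isWalk.reverse⟩
      refine ⟨⟨K.homotopyClass p, K.homotopyClass ⟨p.word.reverse, p.isWalk.reverse⟩, h1, ?_⟩, rfl⟩
      have h3 : (⟨p.word.reverse.reverse, p.isWalk.reverse.reverse⟩ : K.Loop v) = p := by
        apply Loop.ext
        simp [EdgeWord.reverse, Function.comp_def]
      rwa [h3] at h2

/-! ### Ghost vertices -/

open scoped Classical in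
/-- The map `V → V / Y` which identifies all ghost vertices with a single point `none`. -/
noncomputable def collapseVertex (Y : Set V) (v : V) : Option {v : V // v ∉ Y} :=
  if h : v ∈ Y then none else some ⟨v, h⟩

/-- The quotient complex `K / Y`. -/
noncomputable def collapse (K : TwoComplex V E F) (Y : Set V) :
    TwoComplex (Option {v : V // v ∉ Y}) E F where
  toOrientedGraph := K.toOrientedGraph.map (collapseVertex Y)
  base f := collapseVertex Y (K.base f)
  bdry := K.bdry
  bdry_closed f := (K.bdry_closed f).map _

/-- The fundamental group `π₁(K / Y, Y)`. -/
abbrev GhostPi1 (K : TwoComplex V E F) (Y : Set V) := (K.collapse Y).FundamentalGroup none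

/-- A disjoint union `T'` of trees covering all vertices, each of them containing exactly one ghost
vertex (its root); equivalently, a spanning tree of `K / Y`. It comes with a choice, for every
vertex `v`, of a path `path v` in `T'` from `v` to a ghost vertex. -/
structure RootedForest (K : TwoComplex V E F) (Y : Set V) where
  edges : Set E
  acyclic : ∀ (v : V) (w : EdgeWord E), K.IsWalk v w v → (∀ x ∈ w, x.1 ∈ edges) →
    FreeGroup.IsReduced w → w = []
  root_unique : ∀ y ∈ Y, ∀ y' ∈ Y, ∀ w : EdgeWord E, K.IsWalk y w y' →
    (∀ x ∈ w, x.1 ∈ edges) → y = y'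
  path : V → EdgeWord E
  path_isWalk : ∀ v, ∃ y ∈ Y, K.IsWalk v (path v) y
  path_mem : ∀ v, ∀ x ∈ path v, x.1 ∈ edges

namespace RootedForest

variable {K : TwoComplex V E F} {Y : Set V} (T : K.RootedForest Y)

/-- The set `𝒢` of generators: the edges outside of the forest. -/
abbrev Gen := {e : E // e ∉ T.edges}

/-- The loop of `K / Y` which runs from `Y` through the forest to the initial vertex of the
generator `e`, along `e`, and back to `Y` through the forest. -/
noncomputable def loop (e : T.Gen) : (K.collapse Y).Loop none :=
  ⟨(T.path (K.src e)).reverse ++ [(e.1, true)] ++ T.path (K.tgt e), by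
    have hp : ∀ v, (K.collapse Y).IsWalk (collapseVertex Y v) (T.path v) none := by
      intro v
      obtain ⟨y, hy, hw⟩ := T.path_isWalk v
      have := hw.map (collapseVertex Y)
      rwa [show collapseVertex Y y = none from dif_pos hy] at this
    have he : (K.collapse Y).IsWalk (collapseVertex Y (K.src e)) [(e.1, true)]
        (collapseVertex Y (K.tgt e)) := ⟨rfl, rfl⟩
    exact ((hp _).reverse.append he).append (hp _)⟩

/-- The class in `π₁(K / Y, Y)` of the loop of a generator. -/
noncomputable def gen (e : T.Gen) : K.GhostPi1 Y := (K.collapse Y).homotopyClass (T.loop e)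

open scoped Classical in
/-- The relation given by the plaquette `f`: its boundary word, with the forest edges left out. -/
noncomputable def relator (f : F) : FreeGroup T.Gen :=
  FreeGroup.mk ((K.bdry f).filterMap fun x =>
    if h : x.1 ∈ T.edges then none else some (⟨x.1, h⟩, x.2))

end RootedForest

/-! ### The rough quantum double code -/

variable {G : Type*} [Group G]

/-- The holonomy of the connection `g` along an edge path: the ordered product of the group
elements on its edges, inverted where the edge is traversed backwards. -/
def holonomy (g : E → G) (w : EdgeWord E) : G :=
  (w.map fun x => if x.2 then g x.1 else (g x.1)⁻¹).prod

/-- The physical Hilbert space `ℂ[G^E]`. -/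
abbrev State (E G : Type*) := (E → G) →₀ ℂ

/-- The basis state `|g⟩`. -/
noncomputable def ket (g : E → G) : State E G := Finsupp.single g 1

/-- The linear operator sending `|g⟩` to `T g`. -/
noncomputable def ketOp (T : (E → G) → State E G) : Module.End ℂ (State E G) :=
  Finsupp.linearCombination ℂ T

open scoped Classical in
/-- The diagonal operator `|g⟩ ↦ 𝕀(P g) |g⟩`. -/
noncomputable def indicatorOp (P : (E → G) → Prop) : Module.End ℂ (State E G) :=
  ketOp fun g => if P g then ket g else 0

open scoped Classical in
/-- The `X`-check `X_v^h`: it multiplies by `h` from the left on the edges going out of `v`, and by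
`h⁻¹` from the right on the edges coming in to `v` (a loop edge at `v` is conjugated). -/
noncomputable def xCheck (K : TwoComplex V E F) (v : V) (h : G) : Module.End ℂ (State E G) :=
  ketOp fun g => ket fun e =>
    (if K.src e = v then h else 1) * g e * (if K.tgt e = v then h⁻¹ else 1)

/-- The `Z`-check of the plaquette `f`. -/
noncomputable def zCheck (K : TwoComplex V E F) (G : Type*) [Group G] (f : F) :
    Module.End ℂ (State E G) :=
  indicatorOp fun g => holonomy g (K.bdry f) = 1

/-- The codespace of the rough quantum double with ghost vertices `Y`: the states fixed by the
`X`-checks at all vertices outside of `Y` and by all `Z`-checks. -/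
noncomputable def codespace (K : TwoComplex V E F) (Y : Set V) (G : Type*) [Group G] :
    Submodule ℂ (State E G) :=
  (⨅ (v : V) (_ : v ∉ Y) (h : G), LinearMap.eqLocus (K.xCheck v h) 1) ⊓
    ⨅ f : F, LinearMap.eqLocus (K.zCheck G f) 1

/-- The operator `A` commutes with all checks of the code. -/
def CommutesWithChecks (K : TwoComplex V E F) (Y : Set V) (A : Module.End ℂ (State E G)) : Prop :=
  (∀ v ∉ Y, ∀ h : G, Commute A (K.xCheck v h)) ∧ ∀ f : F, Commute A (K.zCheck G f)

/-- The operator `A` is a logical operator: it maps the codespace into itself. -/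
def IsLogical (K : TwoComplex V E F) (Y : Set V) (A : Module.End ℂ (State E G)) : Prop :=
  ∀ ψ ∈ K.codespace Y G, A ψ ∈ K.codespace Y G

theorem CommutesWithChecks.isLogical {K : TwoComplex V E F} {Y : Set V}
    {A : Module.End ℂ (State E G)} (hA : K.CommutesWithChecks Y A) : K.IsLogical Y A := by
  intro ψ hψ
  simp only [codespace, Submodule.mem_inf, Submodule.mem_iInf, LinearMap.mem_eqLocus,
    Module.End.one_apply] at hψ ⊢
  refine ⟨fun v hv h => ?_, fun f => ?_⟩
  · have := LinearMap.congr_fun (hA.1 v hv h).eq ψ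
    simp only [Module.End.mul_apply] at this
    rw [← this, hψ.1 v hv h]
  · have := LinearMap.congr_fun (hA.2 f).eq ψ
    simp only [Module.End.mul_apply] at this
    rw [← this, hψ.2 f]

/-- The operator `A` is of `Z`-type: it is diagonal in the basis `|g⟩`. -/
def IsZType (A : Module.End ℂ (State E G)) : Prop :=
  ∃ d : (E → G) → ℂ, ∀ g, A (ket g) = d g • ket g

open scoped Classical in
/-- The state `|φ⟩`: the sum of all `|g⟩` such that the holonomy of `g` along every closed path of
`K / Y` based at `Y` is the one prescribed by `φ`. -/
noncomputable def codeword (K : TwoComplex V E F) (Y : Set V) [Finite E] [Finite G]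
    (φ : K.GhostPi1 Y →* G) : State E G :=
  Finsupp.equivFunOnFinite.symm fun g =>
    if ∀ p : (K.collapse Y).Loop none, holonomy g p.word = φ ((K.collapse Y).homotopyClass p)
    then 1 else 0

/-! ### The logical operators -/

namespace RootedForest

variable {K : TwoComplex V E F} {Y : Set V} (T : K.RootedForest Y)

/-- The operator `Z^L_{φ, γ}` for the loop `γ` of the generator `e`:
`|g⟩ ↦ 𝕀(g_γ = φ([γ])) |g⟩`. -/
noncomputable def zLogical (φ : K.GhostPi1 Y →* G) (e : T.Gen) : Module.End ℂ (State E G) :=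
  indicatorOp fun g => holonomy g (T.loop e).word = φ (T.gen e)

open scoped Classical in
/-- The map `g ↦ (g with g_e replaced by h^{g_σ} g_e)`, where `h = φ₂(γ) φ₁(γ)⁻¹` and where `σ` is
the path through the forest from the initial vertex of `e` to `Y`. -/
noncomputable def shift (φ₂ φ₁ : K.GhostPi1 Y →* G) (e : T.Gen) (g : E → G) : E → G :=
  Function.update g e
    ((holonomy g (T.path (K.src e)) * (φ₂ (T.gen e) * (φ₁ (T.gen e))⁻¹) *
      (holonomy g (T.path (K.src e)))⁻¹) * g e)

/-- The left multiplication on the edge `e` by `(φ₂(γ) φ₁(γ)⁻¹)^{g_σ}`. -/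
noncomputable def xShift (φ₂ φ₁ : K.GhostPi1 Y →* G) (e : T.Gen) : Module.End ℂ (State E G) :=
  ketOp fun g => ket (T.shift φ₂ φ₁ e g)

theorem holonomy_congr {g g' : E → G} {w : EdgeWord E} (h : ∀ x ∈ w, g x.1 = g' x.1) :
    holonomy g w = holonomy g' w := by
  unfold holonomy
  congr 1
  apply List.map_congr_left
  intro x hx
  rw [h x hx]

theorem shift_apply_of_ne (φ₂ φ₁ : K.GhostPi1 Y →* G) (e : T.Gen) (g : E → G) {d : E}
    (hd : d ≠ e) : T.shift φ₂ φ₁ e g d = g d := by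
  classical
  unfold shift
  exact Function.update_of_ne hd _ _

theorem holonomy_path_shift (φ₂ φ₁ : K.GhostPi1 Y →* G) (e : T.Gen) (g : E → G) (v : V) :
    holonomy (T.shift φ₂ φ₁ e g) (T.path v) = holonomy g (T.path v) :=
  holonomy_congr fun x hx => T.shift_apply_of_ne _ _ _ _
    fun h => e.2 (h ▸ T.path_mem v x hx)

theorem holonomy_loop_shift (φ₂ φ₁ : K.GhostPi1 Y →* G) {e e' : T.Gen} (hne : e ≠ e')
    (g : E → G) :
    holonomy (T.shift φ₂ φ₁ e g) (T.loop e').word = holonomy g (T.loop e').word := by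
  apply holonomy_congr
  intro x hx
  apply T.shift_apply_of_ne
  intro h
  simp only [loop, EdgeWord.reverse, List.mem_append, List.mem_reverse, List.mem_map,
    List.mem_singleton] at hx
  rcases hx with (⟨z, hz, rfl⟩ | rfl) | hx
  · exact e.2 (h ▸ T.path_mem _ z hz)
  · exact hne (Subtype.ext h.symm)
  · exact e.2 (h ▸ T.path_mem _ x hx)

theorem shift_comm (φ₂ φ₁ : K.GhostPi1 Y →* G) {e e' : T.Gen} (hne : e ≠ e') (g : E → G) :
    T.shift φ₂ φ₁ e (T.shift φ₂ φ₁ e' g) = T.shift φ₂ φ₁ e' (T.shift φ₂ φ₁ e g) := by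
  classical
  have hne' : e.1 ≠ e'.1 := fun h => hne (Subtype.ext h)
  conv_lhs => rw [shift]
  conv_rhs => rw [shift]
  simp only [holonomy_path_shift, T.shift_apply_of_ne _ _ e' g hne',
    T.shift_apply_of_ne _ _ e g hne'.symm]
  unfold shift
  rw [Function.update_comm hne'.symm]

theorem xShift_mul_zLogical_ket (φ₂ φ₁ : K.GhostPi1 Y →* G) (e : T.Gen) (g : E → G) :
    (T.xShift φ₂ φ₁ e * T.zLogical φ₁ e) (ket g) =
      open scoped Classical in
      if holonomy g (T.loop e).word = φ₁ (T.gen e) then ket (T.shift φ₂ φ₁ e g) else 0 := by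
  simp only [Module.End.mul_apply, xShift, zLogical, indicatorOp, ketOp, ket,
    Finsupp.linearCombination_single, one_smul]
  split <;> simp

theorem commute_factors (φ₂ φ₁ : K.GhostPi1 Y →* G) {e e' : T.Gen} (hne : e ≠ e') :
    Commute (T.xShift φ₂ φ₁ e * T.zLogical φ₁ e) (T.xShift φ₂ φ₁ e' * T.zLogical φ₁ e') := by
  refine Finsupp.lhom_ext' fun g => LinearMap.ext_ring ?_
  change (T.xShift φ₂ φ₁ e * T.zLogical φ₁ e) ((T.xShift φ₂ φ₁ e' * T.zLogical φ₁ e') (ket g)) =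
    (T.xShift φ₂ φ₁ e' * T.zLogical φ₁ e') ((T.xShift φ₂ φ₁ e * T.zLogical φ₁ e) (ket g))
  rw [xShift_mul_zLogical_ket, xShift_mul_zLogical_ket]
  by_cases h : holonomy g (T.loop e).word = φ₁ (T.gen e) <;>
  by_cases h' : holonomy g (T.loop e').word = φ₁ (T.gen e') <;>
  simp [h, h', xShift_mul_zLogical_ket, holonomy_loop_shift _ _ _ hne,
    holonomy_loop_shift _ _ _ hne.symm, T.shift_comm φ₂ φ₁ hne g, -Module.End.mul_apply]

/-- The operator `X^L_{φ₂ φ₁}`: the product over all generators of the left multiplications on the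
edges outside of the forest, each composed with the `Z`-logical of the generator (the factors of
different generators commute). -/
noncomputable def xLogical [Finite E] (φ₂ φ₁ : K.GhostPi1 Y →* G) : Module.End ℂ (State E G) :=
  haveI := Fintype.ofFinite T.Gen
  (Finset.univ : Finset T.Gen).noncommProd (fun e => T.xShift φ₂ φ₁ e * T.zLogical φ₁ e)
    fun _ _ _ _ hne => T.commute_factors φ₂ φ₁ hne

end RootedForest

end TwoComplex

end QuantumDouble

namespace QuantumDouble

/-! ### Edge words and walks -/

/-! Holonomy along a word depends only on the element of the free group on the edges that it
represents, and so does the homotopy class of a closed path. This reduces the topology to one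
computation. Gauge the universal connection `FreeGroup.of` by the forest paths to `Y`. Forest edges
become trivial and every other edge `q` becomes its loop `γ_q`, while closed paths at `Y` keep their
value because the label at the base point is 1. Hence a closed path at `Y` equals, in the free
group, the product of the `γ_q` read off after deleting the forest edges (`mk_word_eq`,
`homotopyClass_eq`). The presentation of `π` follows.

The codespace consists of the functions supported on flat connections and invariant under gauge
transformations trivial on the ghosts (`mem_codespace_iff`). A flat connection determines a
homomorphism `π → G`, every homomorphism arises, and two connections with the same homomorphism are
gauge equivalent (`exists_hasHolonomy_of_flat`, `exists_hasHolonomy`, `exists_gauge_eq`). So the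
states `|φ⟩` are the indicator functions of the gauge orbits of flat connections, hence a basis.

Homomorphisms are determined on the `γ_q`, so the product over `q` of the `Z`-logicals projects onto
the line of `|φ⟩`; a logical diagonal operator is a combination of these projections. The
simultaneous shift in the `X`-logical is gauge equivariant, thanks to the conjugation by the forest
holonomy, and maps the orbit of `φ₁` bijectively onto that of `φ₂`. The `X`-logicals therefore
restrict to matrix units. -/

theorem EdgeWord.mk_reverse {E : Type*} (w : EdgeWord E) :
    FreeGroup.mk w.reverse = (FreeGroup.mk w)⁻¹ := by
  rw [FreeGroup.inv_mk]; rfl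

namespace OrientedGraph

variable {V E : Type*} {Γ : OrientedGraph V E}

theorem isWalk_append_iff {u v : V} {w w' : EdgeWord E} :
    Γ.IsWalk u (w ++ w') v ↔ ∃ z, Γ.IsWalk u w z ∧ Γ.IsWalk z w' v := by
  refine ⟨fun h => ?_, fun ⟨z, h, h'⟩ => h.append h'⟩
  induction w generalizing u with
  | nil => exact ⟨u, rfl, h⟩
  | cons x w ih =>
    obtain ⟨z, h1, h2⟩ := ih h.2
    exact ⟨z, ⟨h.1, h1⟩, h2⟩

theorem finish_not (x : E × Bool) : Γ.finish (x.1, !x.2) = Γ.start x := by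
  obtain ⟨e, b⟩ := x
  cases b <;> rfl

theorem IsWalk.of_backtrack {u v : V} {a b : EdgeWord E} {x : E × Bool}
    (h : Γ.IsWalk u (a ++ x :: (x.1, !x.2) :: b) v) : Γ.IsWalk u (a ++ b) v := by
  obtain ⟨z, h1, h2⟩ := isWalk_append_iff.1 h
  have h3 := h2.2.2
  rw [finish_not, h2.1] at h3
  exact h1.append h3

/-- The gauge transform of the connection `g` by the vertex labelling `c`. -/
def gauge {G : Type*} [Group G] (Γ : OrientedGraph V E) (c : V → G) (g : E → G) : E → G :=
  fun e => c (Γ.src e) * g e * (c (Γ.tgt e))⁻¹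

end OrientedGraph

namespace TwoComplex

variable {V E F : Type*} {G : Type*} [Group G]

/-! ### Holonomies -/

@[simp] theorem holonomy_nil (g : E → G) : holonomy g [] = 1 := rfl

theorem holonomy_cons (g : E → G) (x : E × Bool) (w : EdgeWord E) :
    holonomy g (x :: w) = (if x.2 then g x.1 else (g x.1)⁻¹) * holonomy g w := by
  simp [holonomy]

theorem holonomy_append (g : E → G) (w w' : EdgeWord E) :
    holonomy g (w ++ w') = holonomy g w * holonomy g w' := by
  simp [holonomy]

theorem holonomy_eq_lift (g : E → G) (w : EdgeWord E) :
    holonomy g w = FreeGroup.lift g (FreeGroup.mk w) := by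
  rw [FreeGroup.lift_mk]
  simp [holonomy, Bool.cond_eq_ite]

theorem holonomy_reverse (g : E → G) (w : EdgeWord E) :
    holonomy g w.reverse = (holonomy g w)⁻¹ := by
  rw [holonomy_eq_lift, EdgeWord.mk_reverse, map_inv, holonomy_eq_lift]

theorem holonomy_of (w : EdgeWord E) : holonomy FreeGroup.of w = FreeGroup.mk w := by
  rw [holonomy_eq_lift, FreeGroup.lift_of_eq_id, MonoidHom.id_apply]

theorem map_holonomy {H : Type*} [Group H] (f : G →* H) (g : E → G) (w : EdgeWord E) :
    f (holonomy g w) = holonomy (fun e => f (g e)) w := by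
  induction w with
  | nil => simp
  | cons x w ih =>
    rw [holonomy_cons, holonomy_cons, map_mul, ih]
    split <;> simp

/-- The labels at interior vertices cancel in pairs, so only those at the two ends survive. -/
theorem holonomy_gauge {Γ : OrientedGraph V E} (c : V → G) (g : E → G) {u v : V} {w : EdgeWord E}
    (h : Γ.IsWalk u w v) : holonomy (Γ.gauge c g) w = c u * holonomy g w * (c v)⁻¹ := by
  induction w generalizing u with
  | nil => cases h; simp
  | cons x w ih =>
    obtain ⟨e, b⟩ := x
    obtain ⟨rfl, h2⟩ := h
    rw [holonomy_cons, holonomy_cons, ih h2]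
    cases b <;> simp [OrientedGraph.gauge, OrientedGraph.start, OrientedGraph.finish, mul_assoc]

/-! ### Homotopy classes -/

section Homotopy

variable {K : TwoComplex V E F} {v : V}

theorem homotopyClass_eq_of_red {w w' : EdgeWord E} (hr : FreeGroup.Red w w')
    (h : K.IsWalk v w v) : ∃ h' : K.IsWalk v w' v,
      K.homotopyClass (⟨w, h⟩ : K.Loop v) = K.homotopyClass ⟨w', h'⟩ := by
  induction hr with
  | refl => exact ⟨h, rfl⟩
  | tail _ hs ih =>
    obtain ⟨h1, e1⟩ := ih
    cases hs with
    | @not a b x c =>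
      have h2 : K.IsWalk v (a ++ b) v := OrientedGraph.IsWalk.of_backtrack (x := (x, c)) h1
      refine ⟨h2, e1.trans (Eq.symm ?_)⟩
      apply Quotient.sound
      apply ConGen.Rel.of
      exact ⟨a, b, rfl, Or.inl ⟨(x, c), by simp⟩⟩

/-- By confluence of free reduction the two words have a common reduct, and each reduction step
removes a backtracking from a path that stays closed. This lets identities in the free group be
transferred to homotopy classes. -/
theorem homotopyClass_eq_of_mk_eq {p q : K.Loop v}
    (h : FreeGroup.mk p.word = FreeGroup.mk q.word) : K.homotopyClass p = K.homotopyClass q := by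
  obtain ⟨w, hp, hq⟩ := FreeGroup.Red.exact.1 h
  obtain ⟨_, e1⟩ := homotopyClass_eq_of_red hp p.isWalk
  obtain ⟨_, e2⟩ := homotopyClass_eq_of_red hq q.isWalk
  exact e1.trans e2.symm

theorem homotopyClass_surjective : Function.Surjective (K.homotopyClass (v := v)) :=
  Con.mk'_surjective

/-- A monoid homomorphism on closed edge paths which does not see backtrackings and boundaries of
plaquettes descends to the fundamental group. -/
noncomputable def liftFundamentalGroup (f : K.Loop v →* G)
    (hf : ∀ p q, K.ElemHomotopy v p q → f p = f q) : K.FundamentalGroup v →* G :=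
  (K.homotopy v).lift f (Con.conGen_le.2 fun p q h => hf p q h)

theorem liftFundamentalGroup_homotopyClass (f : K.Loop v →* G)
    (hf : ∀ p q, K.ElemHomotopy v p q → f p = f q) (p : K.Loop v) :
    liftFundamentalGroup f hf (K.homotopyClass p) = f p := rfl

end Homotopy

theorem collapseVertex_of_mem {Y : Set V} {v : V} (hv : v ∈ Y) : collapseVertex Y v = none :=
  dif_pos hv

theorem collapseVertex_of_notMem {Y : Set V} {v : V} (hv : v ∉ Y) :
    collapseVertex Y v = some ⟨v, hv⟩ :=
  dif_neg hv

/-! ### Generators and relations of the fundamental group from a rooted forest -/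

namespace RootedForest

variable {K : TwoComplex V E F} {Y : Set V} (T : K.RootedForest Y)

/-- Free reduction keeps the word a closed walk in the forest, and acyclicity forces the reduced
walk to be empty. -/
theorem mk_eq_one_of_closed {v : V} {w : EdgeWord E} (h : K.IsWalk v w v)
    (hw : ∀ x ∈ w, x.1 ∈ T.edges) : FreeGroup.mk w = 1 := by
  classical
  have hr : FreeGroup.Red w (FreeGroup.reduce w) := FreeGroup.reduce.red
  have key : ∀ w', FreeGroup.Red w w' → K.IsWalk v w' v ∧ ∀ x ∈ w', x.1 ∈ T.edges := by
    intro w' hr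
    induction hr with
    | refl => exact ⟨h, hw⟩
    | tail _ hs ih =>
      cases hs with
      | @not a b x c =>
        refine ⟨OrientedGraph.IsWalk.of_backtrack (x := (x, c)) ih.1, fun y hy => ih.2 y ?_⟩
        simp only [List.mem_append, List.mem_cons] at hy ⊢
        tauto
  obtain ⟨h1, h2⟩ := key _ hr
  have h3 := T.acyclic v _ h1 h2 (FreeGroup.isReduced_iff_reduce_eq.2 FreeGroup.reduce.idem)
  rw [← FreeGroup.reduce.exact (L₁ := FreeGroup.reduce w) (L₂ := w) FreeGroup.reduce.idem, h3]
  rfl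

theorem mk_eq_one_of_ghosts {y y' : V} (hy : y ∈ Y) (hy' : y' ∈ Y) {w : EdgeWord E}
    (h : K.IsWalk y w y') (hw : ∀ x ∈ w, x.1 ∈ T.edges) : FreeGroup.mk w = 1 := by
  obtain rfl := T.root_unique y hy y' hy' w h hw
  exact T.mk_eq_one_of_closed h hw

theorem collapse_path_isWalk (v : V) :
    (K.collapse Y).IsWalk (collapseVertex Y v) (T.path v) none := by
  obtain ⟨y, hy, hw⟩ := T.path_isWalk v
  have := hw.map (collapseVertex Y)
  rwa [collapseVertex_of_mem hy] at this

/-- The path through the forest from a vertex of `K / Y` to `Y`, as an element of the free group on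
the edges. -/
def potential : Option {v : V // v ∉ Y} → FreeGroup E
  | none => 1
  | some v => FreeGroup.mk (T.path v)

@[simp] theorem potential_none : T.potential none = 1 := rfl

/-- The chosen path at a ghost vertex need not be empty, but it ends at the same ghost vertex and so
is trivial in the free group. The labelling thus descends to `K / Y`. -/
theorem potential_collapseVertex (v : V) :
    T.potential (collapseVertex Y v) = FreeGroup.mk (T.path v) := by
  by_cases hv : v ∈ Y
  · obtain ⟨y, hy, hw⟩ := T.path_isWalk v
    rw [collapseVertex_of_mem hv, potential_none,
      T.mk_eq_one_of_ghosts hv hy hw (T.path_mem v)]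
  · rw [collapseVertex_of_notMem hv]; rfl

/-- The loop of an arbitrary edge, as an element of the free group on the edges. -/
noncomputable def freeLoop : E → FreeGroup E :=
  (K.collapse Y).gauge (fun a => (T.potential a)⁻¹) FreeGroup.of

theorem freeLoop_apply (e : E) : T.freeLoop e =
    (FreeGroup.mk (T.path (K.src e)))⁻¹ * FreeGroup.of e * FreeGroup.mk (T.path (K.tgt e)) := by
  simp only [freeLoop, OrientedGraph.gauge, collapse, OrientedGraph.map,
    potential_collapseVertex, inv_inv]

theorem freeLoop_gen (e : T.Gen) : T.freeLoop e = FreeGroup.mk (T.loop e).word := by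
  rw [freeLoop_apply, ← EdgeWord.mk_reverse, FreeGroup.of, FreeGroup.mul_mk, FreeGroup.mul_mk]
  rfl

/-- The whole loop runs inside the forest from one ghost vertex to another, so it is a closed walk
in a tree. -/
theorem freeLoop_eq_one {e : E} (he : e ∈ T.edges) : T.freeLoop e = 1 := by
  obtain ⟨y, hy, h⟩ := T.path_isWalk (K.src e)
  obtain ⟨y', hy', h'⟩ := T.path_isWalk (K.tgt e)
  have h1 : K.IsWalk (K.src e) [(e, true)] (K.tgt e) := ⟨rfl, rfl⟩
  rw [freeLoop_apply, ← EdgeWord.mk_reverse, FreeGroup.of, FreeGroup.mul_mk, FreeGroup.mul_mk]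
  refine T.mk_eq_one_of_ghosts hy hy' ((h.reverse.append h1).append h') fun x hx => ?_
  simp only [EdgeWord.reverse, List.mem_append, List.mem_reverse, List.mem_map,
    List.mem_singleton] at hx
  rcases hx with (⟨z, hz, rfl⟩ | rfl) | hx
  · exact T.path_mem _ z hz
  · exact he
  · exact T.path_mem _ x hx

open scoped Classical in
/-- An edge word with the forest edges left out. -/
noncomputable def delete (w : EdgeWord E) : EdgeWord T.Gen :=
  w.filterMap fun x => if h : x.1 ∈ T.edges then none else some (⟨x.1, h⟩, x.2)

theorem delete_append (w w' : EdgeWord E) : T.delete (w ++ w') = T.delete w ++ T.delete w' :=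
  List.filterMap_append

theorem delete_eq_nil {w : EdgeWord E} (h : ∀ x ∈ w, x.1 ∈ T.edges) : T.delete w = [] := by
  simp only [delete, List.filterMap_eq_nil_iff]
  intro x hx
  simp [h x hx]

theorem delete_path (v : V) : T.delete (T.path v) = [] := T.delete_eq_nil (T.path_mem v)

theorem delete_path_reverse (v : V) : T.delete (T.path v).reverse = [] := by
  refine T.delete_eq_nil fun x hx => ?_
  simp only [EdgeWord.reverse, List.mem_reverse, List.mem_map] at hx
  obtain ⟨z, hz, rfl⟩ := hx
  exact T.path_mem _ z hz

theorem delete_loop (e : T.Gen) : T.delete (T.loop e).word = [(e, true)] := by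
  simp only [loop, delete_append, delete_path, delete_path_reverse]
  simp [delete, e.2]

theorem relator_eq (f : F) : T.relator f = FreeGroup.mk (T.delete (K.bdry f)) := rfl

/-- Deleting edges is harmless for a connection that is trivial on them. -/
theorem holonomy_delete {t : E → G} (ht : ∀ e ∈ T.edges, t e = 1) (w : EdgeWord E) :
    holonomy (fun e : T.Gen => t e) (T.delete w) = holonomy t w := by
  induction w with
  | nil => rfl
  | cons x w ih =>
    rw [holonomy_cons, ← ih]
    by_cases hx : x.1 ∈ T.edges
    · simp [delete, hx, ht x.1 hx]
    · simp [delete, hx, holonomy_cons]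

/-- Computed in the gauge given by `potential`: the holonomy of the universal connection is
unchanged on closed paths at `Y`, while each edge now carries its `freeLoop`, which is 1 on the
forest. -/
theorem mk_word_eq (p : (K.collapse Y).Loop none) :
    FreeGroup.mk p.word =
      holonomy (fun e => FreeGroup.mk (T.loop e).word) (T.delete p.word) := by
  have h := holonomy_gauge (fun a => (T.potential a)⁻¹) FreeGroup.of p.isWalk
  rw [holonomy_of] at h
  simp only [potential_none, inv_one, one_mul, mul_one] at h
  rw [← h]
  simp only [← freeLoop_gen]
  exact (T.holonomy_delete (fun e he => T.freeLoop_eq_one he) _).symm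

theorem holonomy_loop_eq (g : E → G) (p : (K.collapse Y).Loop none) :
    holonomy g p.word =
      holonomy (fun e => holonomy g (T.loop e).word) (T.delete p.word) := by
  simp only [holonomy_eq_lift g, T.mk_word_eq p, map_holonomy]

/-- A formal product of generators is realised by an actual closed path, which makes it comparable
with other closed paths through their free group elements. -/
theorem exists_loop_of_word (w : EdgeWord T.Gen) : ∃ p : (K.collapse Y).Loop none,
    FreeGroup.mk p.word = holonomy (fun e => FreeGroup.mk (T.loop e).word) w ∧
      (K.collapse Y).homotopyClass p = holonomy T.gen w := by
  induction w with
  | nil => exact ⟨1, rfl, map_one _⟩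
  | cons x w ih =>
    obtain ⟨p, h1, h2⟩ := ih
    obtain ⟨e, b⟩ := x
    cases b
    · refine ⟨⟨_, (T.loop e).isWalk.reverse⟩ * p, ?_, ?_⟩
      · rw [holonomy_cons, ← h1]
        exact FreeGroup.mul_mk.symm.trans (congrArg (· * _) (EdgeWord.mk_reverse _))
      · rw [holonomy_cons, ← h2, map_mul]
        congr 1
        exact eq_inv_of_mul_eq_one_right ((K.collapse Y).homotopyClass_mul_reverse (T.loop e))
    · refine ⟨T.loop e * p, ?_, ?_⟩
      · rw [holonomy_cons, ← h1]
        exact FreeGroup.mul_mk.symm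
      · rw [holonomy_cons, ← h2, map_mul]
        rfl

theorem homotopyClass_eq (p : (K.collapse Y).Loop none) :
    (K.collapse Y).homotopyClass p = holonomy T.gen (T.delete p.word) := by
  obtain ⟨q, h1, h2⟩ := T.exists_loop_of_word (T.delete p.word)
  rw [← h2]
  exact homotopyClass_eq_of_mk_eq ((T.mk_word_eq p).trans h1.symm)

/-- The boundary of a plaquette, joined to `Y` through the forest. -/
theorem lasso_isWalk (f : F) : (K.collapse Y).IsWalk none
    ((T.path (K.base f)).reverse ++ K.bdry f ++ T.path (K.base f)) none :=
  ((T.collapse_path_isWalk _).reverse.append ((K.collapse Y).bdry_closed f)).append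
    (T.collapse_path_isWalk _)

/-- The lasso arises by inserting the plaquette into a path that goes out along the forest and
straight back. -/
theorem homotopyClass_lasso (f : F) :
    (K.collapse Y).homotopyClass ⟨_, T.lasso_isWalk f⟩ = 1 := by
  have hw := (T.collapse_path_isWalk (K.base f)).reverse.append (T.collapse_path_isWalk (K.base f))
  have h1 : (K.collapse Y).homotopyClass ⟨_, hw⟩ = 1 := by
    rw [← map_one (K.collapse Y).homotopyClass]
    apply homotopyClass_eq_of_mk_eq
    rw [← FreeGroup.mul_mk, EdgeWord.mk_reverse, inv_mul_cancel]
    rfl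
  rw [← h1]
  symm
  apply Quotient.sound
  apply ConGen.Rel.of
  exact ⟨_, _, rfl, Or.inr ⟨f, rfl⟩⟩

/-- Both tails of the lasso lie in the forest, so deletion leaves exactly the relator, and the lasso
is null-homotopic. -/
theorem lift_gen_relator : ∀ r ∈ Set.range T.relator, FreeGroup.lift T.gen r = 1 := by
  rintro _ ⟨f, rfl⟩
  have h := T.homotopyClass_eq ⟨_, T.lasso_isWalk f⟩
  rw [homotopyClass_lasso] at h
  simp only [delete_append, delete_path, delete_path_reverse, List.nil_append,
    List.append_nil] at h
  rw [relator_eq, ← holonomy_eq_lift, ← h]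

/-- The word of a closed edge path in the presented group. -/
noncomputable def wordHom :
    (K.collapse Y).Loop none →* PresentedGroup (Set.range T.relator) where
  toFun p := PresentedGroup.mk _ (FreeGroup.mk (T.delete p.word))
  map_one' := map_one _
  map_mul' p q := by
    rw [← map_mul, FreeGroup.mul_mk, ← delete_append]
    rfl

/-- Writing deletion as a holonomy makes the cancellation of backtrackings automatic, also for
backtrackings on forest edges. -/
theorem exists_mk_delete_eq_holonomy :
    ∃ t : E → FreeGroup T.Gen, ∀ w, FreeGroup.mk (T.delete w) = holonomy t w := by
  classical
  refine ⟨fun e => if h : e ∈ T.edges then 1 else FreeGroup.of ⟨e, h⟩, fun w => ?_⟩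
  rw [← holonomy_of, ← T.holonomy_delete (fun e he => by simp [he])]
  congr 1
  ext e
  simp [e.2]

theorem wordHom_apply (p : (K.collapse Y).Loop none) :
    T.wordHom p = PresentedGroup.mk _ (FreeGroup.mk (T.delete p.word)) := rfl

theorem wordHom_eq_of_elemHomotopy (p q : (K.collapse Y).Loop none)
    (h : (K.collapse Y).ElemHomotopy none p q) : T.wordHom p = T.wordHom q := by
  obtain ⟨a, b, hp, ⟨x, hq⟩ | ⟨f, hq⟩⟩ := h
  · obtain ⟨t, ht⟩ := T.exists_mk_delete_eq_holonomy
    simp only [wordHom_apply, hp, hq, ht]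
    congr 1
    simp only [holonomy_append, holonomy_cons, holonomy_nil]
    obtain ⟨e, c⟩ := x
    cases c <;> simp
  · have h1 : PresentedGroup.mk (Set.range T.relator) (FreeGroup.mk (T.delete (K.bdry f))) = 1 :=
      PresentedGroup.one_of_mem ⟨f, rfl⟩
    replace hq : q.word = a ++ K.bdry f ++ b := hq
    simp only [wordHom_apply, hp, hq, delete_append, ← FreeGroup.mul_mk, map_mul, h1, mul_one]

/-- The presentation of `π₁(K / Y, Y)` by the edges outside of the forest and the plaquettes. -/
noncomputable def presentation : PresentedGroup (Set.range T.relator) ≃* K.GhostPi1 Y :=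
  MonoidHom.toMulEquiv
    (PresentedGroup.toGroup T.lift_gen_relator)
    (liftFundamentalGroup T.wordHom T.wordHom_eq_of_elemHomotopy)
    (by
      apply PresentedGroup.ext
      intro e
      simp only [MonoidHom.comp_apply, PresentedGroup.toGroup.of, MonoidHom.id_apply]
      refine (liftFundamentalGroup_homotopyClass _ _ _).trans ?_
      rw [wordHom_apply, delete_loop]
      rfl)
    (by
      ext a
      obtain ⟨p, rfl⟩ := homotopyClass_surjective a
      simp only [MonoidHom.comp_apply, MonoidHom.id_apply]
      rw [liftFundamentalGroup_homotopyClass, T.homotopyClass_eq, holonomy_eq_lift]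
      rfl)

theorem presentation_of (e : T.Gen) : T.presentation (PresentedGroup.of e) = T.gen e :=
  PresentedGroup.toGroup.of T.lift_gen_relator

end RootedForest

/-! ### Existence of rooted forests -/

section Existence

variable (K : TwoComplex V E F) (Y : Set V)

/-- A choice of a first edge of a path to `Y`, for every vertex outside of `Y`, which decreases a
distance. -/
structure Descent where
  dist : V → ℕ
  next : ∀ v, v ∉ Y → E × Bool
  start_next : ∀ v hv, K.start (next v hv) = v
  dist_lt : ∀ v hv, dist (K.finish (next v hv)) < dist v

variable {K Y}

theorem exists_descent (hconn : ∀ v : V, ∃ y ∈ Y, ∃ w : EdgeWord E, K.IsWalk v w y) :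
    Nonempty (Descent K Y) := by
  classical
  have hex : ∀ v, ∃ n, ∃ w : EdgeWord E, w.length = n ∧ ∃ y ∈ Y, K.IsWalk v w y := fun v => by
    obtain ⟨y, hy, w, hw⟩ := hconn v
    exact ⟨_, w, rfl, y, hy, hw⟩
  -- The next edge is the first edge of a shortest path to `Y`.
  have hnext : ∀ v, v ∉ Y → ∃ x : E × Bool, K.start x = v ∧
      Nat.find (hex (K.finish x)) < Nat.find (hex v) := by
    intro v hv
    obtain ⟨w, hl, y, hy, hw⟩ := Nat.find_spec (hex v)
    cases w with
    | nil => cases hw; exact absurd hy hv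
    | cons x w =>
      refine ⟨x, hw.1, ?_⟩
      rw [← hl]
      exact lt_of_le_of_lt (Nat.find_min' _ ⟨w, rfl, y, hy, hw.2⟩) (by simp)
  choose next h1 h2 using hnext
  exact ⟨⟨fun v => Nat.find (hex v), next, h1, h2⟩⟩

namespace Descent

variable (D : Descent K Y)

open scoped Classical in
/-- The path from a vertex to `Y` which follows the chosen edges, and its end. -/
noncomputable def descend (v : V) : EdgeWord E × V :=
  if h : v ∈ Y then ([], v)
  else (D.next v h :: (descend (K.finish (D.next v h))).1, (descend (K.finish (D.next v h))).2)
termination_by D.dist v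
decreasing_by all_goals exact D.dist_lt v h

theorem descend_of_mem {v : V} (hv : v ∈ Y) : D.descend v = ([], v) := by
  rw [descend, dif_pos hv]

theorem descend_of_notMem {v : V} (hv : v ∉ Y) : D.descend v =
    (D.next v hv :: (D.descend (K.finish (D.next v hv))).1,
      (D.descend (K.finish (D.next v hv))).2) := by
  rw [descend, dif_neg hv]

/-- The set of the chosen edges. -/
def edges : Set E := {e | ∃ v hv, (D.next v hv).1 = e}

theorem descend_spec (v : V) : (D.descend v).2 ∈ Y ∧
    K.IsWalk v (D.descend v).1 (D.descend v).2 ∧ ∀ x ∈ (D.descend v).1, x.1 ∈ D.edges := by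
  induction hn : D.dist v using Nat.strong_induction_on generalizing v with
  | _ n ih =>
    subst hn
    by_cases hv : v ∈ Y
    · rw [D.descend_of_mem hv]
      exact ⟨hv, rfl, by simp⟩
    · rw [D.descend_of_notMem hv]
      obtain ⟨h1, h2, h3⟩ := ih _ (D.dist_lt v hv) _ rfl
      refine ⟨h1, ⟨D.start_next v hv, h2⟩, fun x hx => ?_⟩
      rcases List.mem_cons.1 hx with rfl | hx
      · exact ⟨v, hv, rfl⟩
      · exact h3 x hx

/-- A forest edge was chosen at one of its ends, where descending starts with that edge; traversing
it the other way gives the inverted identity. -/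
theorem edge_spec {x : E × Bool} (hx : x.1 ∈ D.edges) :
    FreeGroup.mk (D.descend (K.start x)).1 =
        FreeGroup.mk [x] * FreeGroup.mk (D.descend (K.finish x)).1 ∧
      (D.descend (K.start x)).2 = (D.descend (K.finish x)).2 := by
  have key : ∀ v hv, FreeGroup.mk (D.descend (K.start (D.next v hv))).1 =
        FreeGroup.mk [D.next v hv] * FreeGroup.mk (D.descend (K.finish (D.next v hv))).1 ∧
      (D.descend (K.start (D.next v hv))).2 = (D.descend (K.finish (D.next v hv))).2 := by
    intro v hv
    rw [D.start_next, D.descend_of_notMem hv, FreeGroup.mul_mk]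
    exact ⟨rfl, rfl⟩
  obtain ⟨v, hv, h⟩ := hx
  have hk := key v hv
  generalize D.next v hv = z at h hk
  obtain ⟨e, b⟩ := x
  obtain ⟨e', b'⟩ := z
  obtain rfl : e' = e := h
  by_cases hb : b' = b
  · subst hb; exact hk
  · obtain rfl : b = !b' := by cases b <;> cases b' <;> simp_all
    have h1 : K.finish (e', !b') = K.start (e', b') := OrientedGraph.finish_not (e', b')
    have h2 : K.start (e', !b') = K.finish (e', b') := by cases b' <;> rfl
    have h3 : FreeGroup.mk [(e', !b')] = (FreeGroup.mk [(e', b')])⁻¹ := by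
      rw [FreeGroup.inv_mk]; rfl
    rw [h1, h2, h3]
    exact ⟨by rw [hk.1, inv_mul_cancel_left], hk.2.symm⟩

/-- `edge_spec` telescopes along the walk: in the free group a forest walk is the quotient of the
descents from its ends. This yields acyclicity and uniqueness of the root together. -/
theorem walk_spec {u v : V} {w : EdgeWord E} (h : K.IsWalk u w v)
    (hw : ∀ x ∈ w, x.1 ∈ D.edges) :
    FreeGroup.mk (D.descend u).1 = FreeGroup.mk w * FreeGroup.mk (D.descend v).1 ∧
      (D.descend u).2 = (D.descend v).2 := by
  induction w generalizing u with
  | nil => cases h; exact ⟨(one_mul _).symm, rfl⟩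
  | cons x w ih =>
    obtain ⟨rfl, h2⟩ := h
    obtain ⟨h3, h4⟩ := D.edge_spec (hw x (by simp))
    obtain ⟨h5, h6⟩ := ih h2 fun y hy => hw y (by simp [hy])
    refine ⟨?_, h4.trans h6⟩
    rw [h3, h5, ← mul_assoc, FreeGroup.mul_mk]
    rfl

/-- The forest of the chosen edges. -/
noncomputable def forest : K.RootedForest Y where
  edges := D.edges
  acyclic v w h hw hr := by
    classical
    -- The two ends coincide, so the descents cancel; a reduced word representing 1 is empty.
    have h1 : FreeGroup.mk w = 1 :=
      right_eq_mul.1 (D.walk_spec h hw).1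
    rw [← hr.reduce_eq]
    exact FreeGroup.reduce.sound (L₂ := []) h1
  root_unique y hy y' hy' w h hw := by
    have := (D.walk_spec h hw).2
    rwa [D.descend_of_mem hy, D.descend_of_mem hy'] at this
  path v := (D.descend v).1
  path_isWalk v := ⟨_, (D.descend_spec v).1, (D.descend_spec v).2.1⟩
  path_mem v := (D.descend_spec v).2.2

end Descent

end Existence

/-! ### Operators in the basis `|g⟩` -/

section Operators

variable {G : Type*}

@[simp] theorem ketOp_ket (T : (E → G) → State E G) (g : E → G) : ketOp T (ket g) = T g := by
  simp [ketOp, ket]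

theorem end_ext_ket {A B : Module.End ℂ (State E G)} (h : ∀ g, A (ket g) = B (ket g)) : A = B :=
  Finsupp.lhom_ext' fun g => LinearMap.ext_ring (h g)

open scoped Classical in
@[simp] theorem indicatorOp_ket (P : (E → G) → Prop) (g : E → G) :
    indicatorOp P (ket g) = if P g then ket g else 0 :=
  ketOp_ket _ _

theorem diagonal_apply {A : Module.End ℂ (State E G)} {d : (E → G) → ℂ}
    (h : ∀ g, A (ket g) = d g • ket g) (ψ : State E G) (g : E → G) : A ψ g = d g * ψ g := by
  induction ψ using Finsupp.induction_linear with
  | zero => simp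
  | add ψ ψ' h1 h2 => rw [map_add, Finsupp.add_apply, h1, h2, Finsupp.add_apply, mul_add]
  | single g' a =>
    have h1 : Finsupp.single g' a = a • ket g' := by simp [ket]
    rw [h1, map_smul, h, smul_comm]
    by_cases hg : g' = g
    · subst hg; rfl
    · simp [ket, hg]

open scoped Classical in
theorem indicatorOp_apply (P : (E → G) → Prop) (ψ : State E G) (g : E → G) :
    indicatorOp P ψ g = if P g then ψ g else 0 := by
  rw [diagonal_apply (d := fun g => if P g then 1 else 0)]
  · simp
  · intro g
    rw [indicatorOp_ket]
    split <;> simp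

theorem isZType_indicatorOp (P : (E → G) → Prop) : IsZType (indicatorOp P) := by
  classical
  refine ⟨fun g => if P g then 1 else 0, fun g => ?_⟩
  rw [indicatorOp_ket]
  by_cases h : P g <;> simp [h]

theorem ketOp_ket_eq_mapDomain (t : (E → G) → E → G) (ψ : State E G) :
    ketOp (fun g => ket (t g)) ψ = Finsupp.mapDomain t ψ := by
  simp [ketOp, ket, Finsupp.linearCombination_apply, Finsupp.mapDomain]

end Operators

/-! ### Gauge transformations -/

section Gauge

variable (Γ : OrientedGraph V E)

theorem gauge_one (g : E → G) : Γ.gauge 1 g = g := by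
  ext e; simp [OrientedGraph.gauge]

theorem gauge_mul (c c' : V → G) (g : E → G) : Γ.gauge (c * c') g = Γ.gauge c (Γ.gauge c' g) := by
  ext e; simp [OrientedGraph.gauge, mul_assoc]

theorem gauge_injective (c : V → G) : Function.Injective (Γ.gauge c : (E → G) → E → G) := by
  intro g g' h
  have := congrArg (Γ.gauge c⁻¹) h
  rwa [← gauge_mul, ← gauge_mul, inv_mul_cancel, gauge_one, gauge_one] at this

end Gauge

variable {K : TwoComplex V E F} {Y : Set V}

-- An `X`-check is a gauge transformation of `K / Y` supported at one vertex. Since that vertex is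
-- not a ghost, the label at the collapsed point is 1.
open scoped Classical in
theorem gauge_mulSingle {v : V} (hv : v ∉ Y) (h : G) (g : E → G) :
    (K.collapse Y).gauge (Pi.mulSingle (some ⟨v, hv⟩) h) g = fun e =>
      (if K.src e = v then h else 1) * g e * (if K.tgt e = v then h⁻¹ else 1) := by
  have key : ∀ u : V, (Pi.mulSingle (some ⟨v, hv⟩) h : Option {v : V // v ∉ Y} → G)
      (collapseVertex Y u) = if u = v then h else 1 := by
    intro u
    by_cases hu : u ∈ Y
    · have : u ≠ v := fun h => hv (h ▸ hu)
      simp [collapseVertex_of_mem hu, this]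
    · simp [collapseVertex_of_notMem hu, Pi.mulSingle_apply]
  ext e
  simp only [OrientedGraph.gauge, collapse, OrientedGraph.map, key]
  congr 1
  split <;> simp

open scoped Classical in
theorem xCheck_eq {v : V} (hv : v ∉ Y) (h : G) :
    (K.xCheck v h : Module.End ℂ (State E G)) =
      ketOp fun g => ket ((K.collapse Y).gauge (Pi.mulSingle (some ⟨v, hv⟩) h) g) := by
  simp only [gauge_mulSingle]
  rfl

open scoped Classical in
theorem xCheck_apply_gauge {v : V} (hv : v ∉ Y) (h : G) (ψ : State E G) (g : E → G) :
    K.xCheck v h ψ ((K.collapse Y).gauge (Pi.mulSingle (some ⟨v, hv⟩) h) g) = ψ g := by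
  rw [xCheck_eq hv, ketOp_ket_eq_mapDomain, Finsupp.mapDomain_apply (gauge_injective _ _)]

/-- Only the edges are assumed finite, but each non-ghost vertex begins a nonempty path to `Y`.
Finiteness allows every admissible gauge transformation to be a finite product of checks. -/
theorem finite_nonghost [Finite E]
    (hconn : ∀ v : V, ∃ y ∈ Y, ∃ w : EdgeWord E, K.IsWalk v w y) : Finite {v : V // v ∉ Y} := by
  refine Set.Finite.subset (Set.finite_range K.start) fun v hv => ?_
  obtain ⟨y, hy, w, hw⟩ := hconn v
  cases w with
  | nil => cases hw; exact absurd hy hv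
  | cons x w => exact ⟨x, hw.1⟩

/-- A property of vertex labellings which are trivial at the base point follows from the case of
labellings supported at a single vertex. -/
theorem label_induction {ι : Type*} [Finite ι] [DecidableEq ι] {P : (Option ι → G) → Prop}
    (one : P 1) (mul : ∀ c c', P c → P c' → P (c * c'))
    (single : ∀ i h, P (Pi.mulSingle (some i) h)) {c : Option ι → G} (hc : c none = 1) : P c := by
  have := Fintype.ofFinite ι
  have key : ∀ (s : Finset ι) (c : Option ι → G), c none = 1 → (∀ i ∉ s, c (some i) = 1) →
      P c := by
    intro s
    induction s using Finset.induction_on with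
    | empty =>
      intro c hc h
      have : c = 1 := by
        ext a
        cases a with
        | none => exact hc
        | some i => exact h i (by simp)
      rwa [this]
    | insert i s hi ih =>
      intro c hc h
      -- Split off the value at `i`; the other factor is trivial outside `s`.
      have : c = Pi.mulSingle (some i) (c (some i)) * Function.update c (some i) 1 := by
        ext a
        by_cases ha : a = some i
        · subst ha; simp
        · simp [ha]
      rw [this]
      refine mul _ _ (single _ _) (ih _ (by simpa using hc) fun j hj => ?_)
      by_cases hji : j = i
      · subst hji; simp
      · rw [Function.update_of_ne (by simpa using hji)]
        exact h j (by simp [hji, hj])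
  exact key Finset.univ c hc (by simp)

/-- Invariance under the single-vertex transformations propagates to all labellings trivial at the
base point, and the projections `zCheck` fix exactly the functions supported on flat connections. -/
theorem mem_codespace_iff [Finite {v : V // v ∉ Y}] {ψ : State E G} : ψ ∈ K.codespace Y G ↔
    (∀ c : Option {v : V // v ∉ Y} → G, c none = 1 →
      ∀ g, ψ ((K.collapse Y).gauge c g) = ψ g) ∧
    ∀ g, ψ g ≠ 0 → ∀ f, holonomy g (K.bdry f) = 1 := by
  classical
  simp only [codespace, Submodule.mem_inf, Submodule.mem_iInf, LinearMap.mem_eqLocus,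
    Module.End.one_apply]
  refine and_congr ⟨fun h c hc => ?_, fun h v hv a => ?_⟩ ⟨fun h g hg f => ?_, fun h f => ?_⟩
  · refine label_induction
      (P := fun c => ∀ g, ψ ((K.collapse Y).gauge c g) = ψ g) ?_ ?_ ?_ hc
    · intro g; rw [gauge_one]
    · intro c c' h1 h2 g; rw [gauge_mul, h1, h2]
    · intro i a g
      have := xCheck_apply_gauge i.2 a ψ g (K := K)
      rwa [h i.1 i.2 a] at this
  · ext g
    obtain ⟨g, rfl⟩ : ∃ g', (K.collapse Y).gauge (Pi.mulSingle (some ⟨v, hv⟩) a) g' = g :=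
      ⟨(K.collapse Y).gauge (Pi.mulSingle (some ⟨v, hv⟩) a)⁻¹ g, by
        rw [← gauge_mul, mul_inv_cancel, gauge_one]⟩
    rw [xCheck_apply_gauge hv, h _ (by simp)]
  · by_contra hf
    have := DFunLike.congr_fun (h f) g
    rw [zCheck, indicatorOp_apply, if_neg hf] at this
    exact hg this.symm
  · ext g
    rw [zCheck, indicatorOp_apply]
    split
    · rfl
    · by_contra hne
      exact (by assumption : ¬ _) (h g (Ne.symm hne) f)

/-! ### Connections with prescribed holonomies -/

/-- The holonomy of `g` along every closed path of `K / Y` based at `Y` is given by `φ`. -/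
def HasHolonomy (φ : K.GhostPi1 Y →* G) (g : E → G) : Prop :=
  ∀ p : (K.collapse Y).Loop none, holonomy g p.word = φ ((K.collapse Y).homotopyClass p)

theorem holonomy_gauge_loop {c : Option {v : V // v ∉ Y} → G} (hc : c none = 1) (g : E → G)
    (p : (K.collapse Y).Loop none) :
    holonomy ((K.collapse Y).gauge c g) p.word = holonomy g p.word := by
  rw [holonomy_gauge c g p.isWalk, hc]
  simp

theorem hasHolonomy_gauge_iff {φ : K.GhostPi1 Y →* G} {c : Option {v : V // v ∉ Y} → G}
    (hc : c none = 1) {g : E → G} :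
    HasHolonomy φ ((K.collapse Y).gauge c g) ↔ HasHolonomy φ g := by
  simp only [HasHolonomy, holonomy_gauge_loop hc]

theorem HasHolonomy.unique {φ φ' : K.GhostPi1 Y →* G} {g : E → G} (h : HasHolonomy φ g)
    (h' : HasHolonomy φ' g) : φ = φ' := by
  ext a
  obtain ⟨p, rfl⟩ := homotopyClass_surjective a
  rw [← h, ← h']

/-- Holonomy never sees backtrackings, and flatness says that it does not see plaquettes, so it
descends to `π`. -/
theorem exists_hasHolonomy_of_flat {g : E → G} (hg : ∀ f, holonomy g (K.bdry f) = 1) :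
    ∃ φ : K.GhostPi1 Y →* G, HasHolonomy φ g := by
  let hol : (K.collapse Y).Loop none →* G :=
    { toFun := fun p => holonomy g p.word
      map_one' := rfl
      map_mul' := fun p q => holonomy_append g p.word q.word }
  refine ⟨liftFundamentalGroup hol ?_, fun p => rfl⟩
  rintro p q ⟨a, b, hp, ⟨x, hq⟩ | ⟨f, hq⟩⟩
  · change holonomy g p.word = holonomy g q.word
    rw [hp, hq]
    simp only [holonomy_append, holonomy_cons, holonomy_nil]
    obtain ⟨e, c⟩ := x
    cases c <;> simp
  · change holonomy g p.word = holonomy g q.word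
    replace hq : q.word = a ++ K.bdry f ++ b := hq
    rw [hp, hq, holonomy_append, holonomy_append, holonomy_append, hg, mul_one]

namespace RootedForest

variable (T : K.RootedForest Y)

theorem hasHolonomy_iff {φ : K.GhostPi1 Y →* G} {g : E → G} :
    HasHolonomy φ g ↔ ∀ e, holonomy g (T.loop e).word = φ (T.gen e) := by
  refine ⟨fun h e => h _, fun h p => ?_⟩
  rw [T.holonomy_loop_eq, T.homotopyClass_eq, map_holonomy]
  simp only [h]

theorem hom_ext (T : K.RootedForest Y) {φ φ' : K.GhostPi1 Y →* G} (h : ∀ e, φ (T.gen e) = φ' (T.gen e)) : φ = φ' := by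
  ext a
  obtain ⟨p, rfl⟩ := homotopyClass_surjective a
  simp only [T.homotopyClass_eq, map_holonomy, h]

theorem finite_hom (T : K.RootedForest Y) [Finite E] [Finite G] : Finite (K.GhostPi1 Y →* G) :=
  Finite.of_injective (fun φ e => φ (T.gen e)) fun _ _ h => T.hom_ext (congrFun h)

/-- The holonomy of the null-homotopic lasso is a conjugate of the holonomy around the plaquette. -/
theorem flat_of_hasHolonomy (T : K.RootedForest Y) {φ : K.GhostPi1 Y →* G} {g : E → G} (h : HasHolonomy φ g) (f : F) :
    holonomy g (K.bdry f) = 1 := by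
  have h1 := h ⟨_, T.lasso_isWalk f⟩
  rw [T.homotopyClass_lasso, map_one, holonomy_append, holonomy_append, holonomy_reverse,
    mul_assoc, inv_mul_eq_one] at h1
  exact mul_eq_right.1 h1.symm

/-- The witness is the connection in forest gauge: 1 on the forest and the prescribed value on each
generator. -/
theorem exists_hasHolonomy (T : K.RootedForest Y) (φ : K.GhostPi1 Y →* G) : ∃ g : E → G, HasHolonomy φ g := by
  classical
  refine ⟨fun e => if h : e ∈ T.edges then 1 else φ (T.gen ⟨e, h⟩), T.hasHolonomy_iff.2 fun e => ?_⟩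
  rw [← T.holonomy_delete (fun e he => by simp [he]), delete_loop]
  simp [holonomy_cons, e.2]

/-- The label at a vertex compares the parallel transports to `Y` under the two connections. It
carries one to the other because both have equal holonomy on the loop of every edge, forest edges
included. -/
theorem exists_gauge_eq (T : K.RootedForest Y) {φ : K.GhostPi1 Y →* G} {g g' : E → G} (h : HasHolonomy φ g)
    (h' : HasHolonomy φ g') :
    ∃ c : Option {v : V // v ∉ Y} → G, c none = 1 ∧ (K.collapse Y).gauge c g = g' := by
  refine ⟨fun a => FreeGroup.lift g' (T.potential a) * (FreeGroup.lift g (T.potential a))⁻¹,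
    by simp, ?_⟩
  ext e
  have key : FreeGroup.lift g (T.freeLoop e) = FreeGroup.lift g' (T.freeLoop e) := by
    by_cases he : e ∈ T.edges
    · rw [T.freeLoop_eq_one he, map_one, map_one]
    · rw [T.freeLoop_gen ⟨e, he⟩, ← holonomy_eq_lift, ← holonomy_eq_lift, h, h']
  simp only [freeLoop_apply, map_mul, map_inv, FreeGroup.lift_apply_of] at key
  simp only [OrientedGraph.gauge, collapse, OrientedGraph.map, potential_collapseVertex]
  generalize FreeGroup.lift g (FreeGroup.mk (T.path (K.src e))) = A at *
  generalize FreeGroup.lift g (FreeGroup.mk (T.path (K.tgt e))) = B at *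
  generalize FreeGroup.lift g' (FreeGroup.mk (T.path (K.src e))) = A' at *
  generalize FreeGroup.lift g' (FreeGroup.mk (T.path (K.tgt e))) = B' at *
  calc A' * A⁻¹ * g e * (B' * B⁻¹)⁻¹ = A' * (A⁻¹ * g e * B) * B'⁻¹ := by group
    _ = g' e := by rw [key]; group

theorem eq_of_mem_codespace (T : K.RootedForest Y) [Finite {v : V // v ∉ Y}] {ψ : State E G}
    (hψ : ψ ∈ K.codespace Y G) {φ : K.GhostPi1 Y →* G} {g g' : E → G} (h : HasHolonomy φ g)
    (h' : HasHolonomy φ g') : ψ g = ψ g' := by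
  obtain ⟨c, hc, rfl⟩ := T.exists_gauge_eq h h'
  exact ((mem_codespace_iff.1 hψ).1 c hc g).symm

end RootedForest

/-! ### The basis of the codespace -/

section Codespace

variable [Finite E] [Finite G]

open scoped Classical in
theorem codeword_apply (φ : K.GhostPi1 Y →* G) (g : E → G) :
    K.codeword Y φ g = if HasHolonomy φ g then 1 else 0 := rfl

open scoped Classical in
theorem codeword_eq_sum [Fintype (E → G)] (φ : K.GhostPi1 Y →* G) :
    K.codeword Y φ = ∑ g with HasHolonomy φ g, ket g := by
  ext g
  rw [codeword_apply, Finsupp.finsetSum_apply]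
  simp [ket, Finsupp.single_apply, Finset.sum_ite_eq']

namespace RootedForest

variable (T : K.RootedForest Y)

theorem codeword_mem (T : K.RootedForest Y) [Finite {v : V // v ∉ Y}] (φ : K.GhostPi1 Y →* G) :
    K.codeword Y φ ∈ K.codespace Y G := by
  classical
  refine mem_codespace_iff.2 ⟨fun c hc g => ?_, fun g hg => ?_⟩
  · simp only [codeword_apply, hasHolonomy_gauge_iff hc]
  · rw [codeword_apply] at hg
    exact T.flat_of_hasHolonomy (of_not_not fun h => hg (if_neg h))

/-- The states have nonempty, pairwise disjoint supports. -/
theorem linearIndependent_codeword (T : K.RootedForest Y) :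
    LinearIndependent ℂ (fun φ : K.GhostPi1 Y →* G => K.codeword Y φ) := by
  classical
  have := T.finite_hom (G := G)
  have := Fintype.ofFinite (K.GhostPi1 Y →* G)
  refine Fintype.linearIndependent_iff.2 fun a ha φ => ?_
  obtain ⟨g, hg⟩ := T.exists_hasHolonomy φ
  have h := DFunLike.congr_fun ha g
  rw [Finsupp.finsetSum_apply, Finset.sum_eq_single φ] at h
  · simpa [codeword_apply, hg] using h
  · intro φ' _ hne
    rw [Finsupp.smul_apply, codeword_apply, if_neg fun h => hne (h.unique hg), smul_zero]
  · simp

theorem span_codeword (T : K.RootedForest Y) [Finite {v : V // v ∉ Y}] :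
    Submodule.span ℂ (Set.range fun φ : K.GhostPi1 Y →* G => K.codeword Y φ) =
      K.codespace Y G := by
  classical
  have := T.finite_hom (G := G)
  have := Fintype.ofFinite (K.GhostPi1 Y →* G)
  refine le_antisymm (Submodule.span_le.2 ?_) fun ψ hψ => ?_
  · rintro _ ⟨φ, rfl⟩
    exact T.codeword_mem φ
  · choose rep hrep using T.exists_hasHolonomy (G := G)
    -- The coefficient of `|φ⟩` is the constant value of `ψ` on the connections with holonomy `φ`;
    -- off the flat connections both sides vanish.
    have : ψ = ∑ φ, ψ (rep φ) • K.codeword Y φ := by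
      ext g
      rw [Finsupp.finsetSum_apply]
      by_cases hg : ∃ φ : K.GhostPi1 Y →* G, HasHolonomy φ g
      · obtain ⟨φ, hφ⟩ := hg
        rw [Finset.sum_eq_single φ]
        · simp [codeword_apply, hφ, T.eq_of_mem_codespace hψ hφ (hrep φ)]
        · intro φ' _ hne
          rw [Finsupp.smul_apply, codeword_apply, if_neg fun h => hne (h.unique hφ), smul_zero]
        · simp
      · have h0 : ψ g = 0 := by
          by_contra h
          exact hg (exists_hasHolonomy_of_flat ((mem_codespace_iff.1 hψ).2 g h))
        rw [h0]
        refine (Finset.sum_eq_zero fun φ _ => ?_).symm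
        rw [Finsupp.smul_apply, codeword_apply, if_neg fun h => hg ⟨φ, h⟩, smul_zero]
    rw [this]
    exact Submodule.sum_mem _ fun φ _ =>
      Submodule.smul_mem _ _ (Submodule.subset_span ⟨φ, rfl⟩)

/-- The basis of the codespace formed by the states `|φ⟩`. -/
noncomputable def codewordBasis [Finite {v : V // v ∉ Y}] :
    Module.Basis (K.GhostPi1 Y →* G) ℂ (K.codespace Y G) :=
  (Module.Basis.span T.linearIndependent_codeword).map (LinearEquiv.ofEq _ _ T.span_codeword)

theorem coe_codewordBasis [Finite {v : V // v ∉ Y}] (φ : K.GhostPi1 Y →* G) :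
    (T.codewordBasis φ : State E G) = K.codeword Y φ := by
  rw [codewordBasis, Module.Basis.map_apply, LinearEquiv.coe_ofEq_apply]
  exact congrArg Subtype.val (Module.Basis.span_apply T.linearIndependent_codeword φ)

end RootedForest

end Codespace

namespace RootedForest

variable (T : K.RootedForest Y)

/-! ### The `Z`-logicals -/

theorem commutesWithChecks_zLogical (φ : K.GhostPi1 Y →* G) (e : T.Gen) :
    K.CommutesWithChecks Y (T.zLogical φ e) := by
  classical
  refine ⟨fun v hv h => end_ext_ket fun g => ?_, fun f => end_ext_ket fun g => ?_⟩
  · rw [Module.End.mul_apply, Module.End.mul_apply, xCheck_eq hv, zLogical, ketOp_ket,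
      indicatorOp_ket, indicatorOp_ket,
      holonomy_gauge_loop (by simp)]
    split <;> simp
  · rw [Module.End.mul_apply, Module.End.mul_apply, zLogical, zCheck, indicatorOp_ket,
      indicatorOp_ket]
    split_ifs <;> simp [*]

section

variable [Finite E] [Finite G]

open scoped Classical in
theorem zLogical_codeword (φ φ' : K.GhostPi1 Y →* G) (e : T.Gen) :
    T.zLogical φ e (K.codeword Y φ') =
      if φ' (T.gen e) = φ (T.gen e) then K.codeword Y φ' else 0 := by
  ext g
  rw [zLogical, indicatorOp_apply, codeword_apply]
  by_cases hg : HasHolonomy φ' g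
  · rw [hg (T.loop e)]
    change (if φ' (T.gen e) = _ then _ else _) = _
    split <;> simp [codeword_apply, hg]
  · simp only [if_neg hg, ite_self]
    split <;> simp [codeword_apply, hg]

-- When the list contains all generators, this product is the projection onto the line of `|φ⟩`.
open scoped Classical in
theorem prod_zLogical_codewordBasis [Finite {v : V // v ∉ Y}] (φ φ' : K.GhostPi1 Y →* G)
    (l : List T.Gen) :
    (l.map fun e => (T.zLogical φ e).restrict (T.commutesWithChecks_zLogical φ e).isLogical).prod
        (T.codewordBasis φ') =
      if ∀ e ∈ l, φ' (T.gen e) = φ (T.gen e) then T.codewordBasis φ' else 0 := by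
  induction l with
  | nil => simp
  | cons e l ih =>
    rw [List.map_cons, List.prod_cons, Module.End.mul_apply, ih]
    have h1 : (T.zLogical φ e).restrict (T.commutesWithChecks_zLogical φ e).isLogical
        (T.codewordBasis φ') = if φ' (T.gen e) = φ (T.gen e) then T.codewordBasis φ' else 0 := by
      apply Subtype.ext
      change T.zLogical φ e (T.codewordBasis φ' : State E G) = _
      rw [coe_codewordBasis, zLogical_codeword]
      split
      · rw [coe_codewordBasis]
      · rfl
    simp only [List.forall_mem_cons]
    by_cases h2 : ∀ e ∈ l, φ' (T.gen e) = φ (T.gen e)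
    · rw [if_pos h2, h1]
      exact if_congr (and_iff_left h2).symm rfl rfl
    · rw [if_neg h2, map_zero, if_neg fun h => h2 h.2]

/-- The image lies in the codespace, so it is constant on the connections with holonomy `φ`; the
diagonal entries there all agree with the one at a representative. -/
theorem exists_eigenvalue_of_isZType (T : K.RootedForest Y) [Finite {v : V // v ∉ Y}] {D : Module.End ℂ (State E G)}
    (hD : K.IsLogical Y D) (hZ : IsZType D) (φ : K.GhostPi1 Y →* G) :
    ∃ a : ℂ, D (K.codeword Y φ) = a • K.codeword Y φ := by
  classical
  obtain ⟨d, hd⟩ := hZ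
  obtain ⟨g₀, h₀⟩ := T.exists_hasHolonomy φ
  refine ⟨d g₀, ?_⟩
  ext g
  by_cases hg : HasHolonomy φ g
  · rw [T.eq_of_mem_codespace (hD _ (T.codeword_mem φ)) hg h₀, diagonal_apply hd]
    simp [codeword_apply, hg, h₀]
  · rw [diagonal_apply hd]
    simp [codeword_apply, hg]

theorem mem_adjoin_zLogical_iff [Finite {v : V // v ∉ Y}]
    (B : Module.End ℂ (K.codespace Y G)) :
    B ∈ Algebra.adjoin ℂ (Set.range fun p : (K.GhostPi1 Y →* G) × T.Gen =>
        (T.zLogical p.1 p.2).restrict (T.commutesWithChecks_zLogical p.1 p.2).isLogical) ↔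
      ∃ (D : Module.End ℂ (State E G)) (hD : K.IsLogical Y D), IsZType D ∧ D.restrict hD = B := by
  classical
  constructor
  · intro hB
    induction hB using Algebra.adjoin_induction with
    | mem B hB =>
      obtain ⟨p, rfl⟩ := hB
      exact ⟨_, _, isZType_indicatorOp _, rfl⟩
    | algebraMap a =>
      refine ⟨a • 1, fun ψ hψ => Submodule.smul_mem _ a hψ, ⟨fun _ => a, fun g => rfl⟩, ?_⟩
      ext; rfl
    | add B B' _ _ h h' =>
      obtain ⟨D, hD, ⟨d, hd⟩, rfl⟩ := h
      obtain ⟨D', hD', ⟨d', hd'⟩, rfl⟩ := h'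
      refine ⟨D + D', fun ψ hψ => Submodule.add_mem _ (hD ψ hψ) (hD' ψ hψ),
        ⟨fun g => d g + d' g, fun g => ?_⟩, ?_⟩
      · rw [LinearMap.add_apply, hd, hd', add_smul]
      · ext; rfl
    | mul B B' _ _ h h' =>
      obtain ⟨D, hD, ⟨d, hd⟩, rfl⟩ := h
      obtain ⟨D', hD', ⟨d', hd'⟩, rfl⟩ := h'
      refine ⟨D * D', fun ψ hψ => hD _ (hD' ψ hψ), ⟨fun g => d' g * d g, fun g => ?_⟩, ?_⟩
      · rw [Module.End.mul_apply, hd', map_smul, hd, smul_smul]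
      · ext; rfl
  · rintro ⟨D, hD, hZ, rfl⟩
    have := T.finite_hom (G := G)
    have := Fintype.ofFinite (K.GhostPi1 Y →* G)
    have := Fintype.ofFinite T.Gen
    choose a ha using T.exists_eigenvalue_of_isZType hD hZ
    -- Spectral decomposition: eigenvalues times the projections onto the lines of `|φ⟩`.
    have : D.restrict hD = ∑ φ, a φ • ((Finset.univ : Finset T.Gen).toList.map fun e =>
        (T.zLogical φ e).restrict (T.commutesWithChecks_zLogical φ e).isLogical).prod := by
      refine T.codewordBasis.ext fun φ => ?_
      rw [LinearMap.sum_apply, Finset.sum_eq_single φ]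
      · rw [LinearMap.smul_apply, prod_zLogical_codewordBasis, if_pos fun _ _ => rfl]
        apply Subtype.ext
        change D (T.codewordBasis φ : State E G) = _
        rw [Submodule.coe_smul, coe_codewordBasis, ha]
      · intro φ' _ hne
        rw [LinearMap.smul_apply, prod_zLogical_codewordBasis, if_neg, smul_zero]
        intro h
        exact hne (T.hom_ext fun e => (h e (by simp)).symm)
      · simp
    rw [this]
    refine Subalgebra.sum_mem _ fun φ _ => Subalgebra.smul_mem _ (Subalgebra.list_prod_mem _ ?_) _
    intro B hB
    obtain ⟨e, _, rfl⟩ := List.mem_map.1 hB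
    exact Algebra.subset_adjoin ⟨(φ, e), rfl⟩

end

/-! ### The logical matrix units -/

section Shift

variable (φ₂ φ₁ : K.GhostPi1 Y →* G)

open scoped Classical in
/-- The simultaneous application of the maps `T.shift φ₂ φ₁ e` for all `e ∈ s`. -/
noncomputable def shiftOn (s : Set T.Gen) (g : E → G) : E → G := fun d =>
  if h : ∃ hd : d ∉ T.edges, (⟨d, hd⟩ : T.Gen) ∈ s then T.shift φ₂ φ₁ ⟨d, h.1⟩ g d else g d

variable {φ₂ φ₁}

theorem shift_apply_self (e : T.Gen) (g : E → G) : T.shift φ₂ φ₁ e g e =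
    holonomy g (T.path (K.src e)) * (φ₂ (T.gen e) * (φ₁ (T.gen e))⁻¹) *
      (holonomy g (T.path (K.src e)))⁻¹ * g e := by
  simp [shift]

theorem shiftOn_apply_of_mem {s : Set T.Gen} {e : T.Gen} (he : e ∈ s) (g : E → G) :
    T.shiftOn φ₂ φ₁ s g e = T.shift φ₂ φ₁ e g e :=
  dif_pos ⟨e.2, he⟩

theorem shiftOn_apply_of_notMem {s : Set T.Gen} {e : T.Gen} (he : e ∉ s) (g : E → G) :
    T.shiftOn φ₂ φ₁ s g e = g e :=
  dif_neg fun h => he h.2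

theorem shiftOn_apply_of_mem_edges {s : Set T.Gen} {d : E} (hd : d ∈ T.edges) (g : E → G) :
    T.shiftOn φ₂ φ₁ s g d = g d :=
  dif_neg fun h => h.1 hd

theorem shiftOn_empty (g : E → G) : T.shiftOn φ₂ φ₁ ∅ g = g := by
  ext d
  exact dif_neg fun h => h.2

/-- The multipliers involve holonomies through the forest only, so shifting the edge `a` does not
disturb the remaining shifts. -/
theorem shiftOn_shift {s : Set T.Gen} {a : T.Gen} (ha : a ∉ s) (g : E → G) :
    T.shiftOn φ₂ φ₁ s (T.shift φ₂ φ₁ a g) = T.shiftOn φ₂ φ₁ (insert a s) g := by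
  ext d
  by_cases hd : d ∈ T.edges
  · rw [T.shiftOn_apply_of_mem_edges hd, T.shiftOn_apply_of_mem_edges hd,
      T.shift_apply_of_ne _ _ _ _ fun h => a.2 (h ▸ hd)]
  · obtain ⟨e, rfl⟩ : ∃ e : T.Gen, e.1 = d := ⟨⟨d, hd⟩, rfl⟩
    by_cases hea : e = a
    · subst hea
      rw [T.shiftOn_apply_of_notMem ha, T.shiftOn_apply_of_mem (Set.mem_insert _ _)]
    · have hne : e.1 ≠ a.1 := fun h => hea (Subtype.ext h)
      by_cases hes : e ∈ s
      · rw [T.shiftOn_apply_of_mem hes, T.shiftOn_apply_of_mem (Set.mem_insert_of_mem _ hes),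
          shift_apply_self, shift_apply_self, holonomy_path_shift, T.shift_apply_of_ne _ _ _ _ hne]
      · rw [T.shiftOn_apply_of_notMem hes, T.shift_apply_of_ne _ _ _ _ hne,
          T.shiftOn_apply_of_notMem (by simp [hea, hes])]

theorem holonomy_path_shiftOn (s : Set T.Gen) (g : E → G) (v : V) :
    holonomy (T.shiftOn φ₂ φ₁ s g) (T.path v) = holonomy g (T.path v) :=
  holonomy_congr fun x hx => T.shiftOn_apply_of_mem_edges (T.path_mem v x hx) g

theorem holonomy_loop (g : E → G) (e : T.Gen) : holonomy g (T.loop e).word =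
    (holonomy g (T.path (K.src e)))⁻¹ * g e * holonomy g (T.path (K.tgt e)) := by
  rw [loop, holonomy_append, holonomy_append, holonomy_reverse, holonomy_cons]
  simp

/-- Conjugation by the forest holonomy cancels against the first leg of the loop, so the loop
holonomy is multiplied on the left by exactly `φ₂(γ) φ₁(γ)⁻¹`. -/
theorem hasHolonomy_shiftOn_univ {g : E → G} (h : HasHolonomy φ₁ g) :
    HasHolonomy φ₂ (T.shiftOn φ₂ φ₁ Set.univ g) := by
  refine T.hasHolonomy_iff.2 fun e => ?_
  have h1 := T.hasHolonomy_iff.1 h e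
  rw [holonomy_loop] at h1 ⊢
  rw [holonomy_path_shiftOn, holonomy_path_shiftOn, T.shiftOn_apply_of_mem (Set.mem_univ _),
    shift_apply_self, ← h1]
  group

theorem shiftOn_univ_shiftOn_univ (g : E → G) :
    T.shiftOn φ₁ φ₂ Set.univ (T.shiftOn φ₂ φ₁ Set.univ g) = g := by
  ext d
  by_cases hd : d ∈ T.edges
  · rw [T.shiftOn_apply_of_mem_edges hd, T.shiftOn_apply_of_mem_edges hd]
  · obtain ⟨e, rfl⟩ : ∃ e : T.Gen, e.1 = d := ⟨⟨d, hd⟩, rfl⟩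
    rw [T.shiftOn_apply_of_mem (Set.mem_univ _), shift_apply_self, holonomy_path_shiftOn,
      T.shiftOn_apply_of_mem (Set.mem_univ _), shift_apply_self]
    group

/-- A gauge transformation conjugates the multiplier by the label at the initial vertex, since the
forest path ends where the label is 1; this matches the left factor acting on the edge. -/
theorem shiftOn_gauge {c : Option {v : V // v ∉ Y} → G} (hc : c none = 1) (s : Set T.Gen)
    (g : E → G) : T.shiftOn φ₂ φ₁ s ((K.collapse Y).gauge c g) =
      (K.collapse Y).gauge c (T.shiftOn φ₂ φ₁ s g) := by
  ext d
  conv_rhs => rw [OrientedGraph.gauge]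
  by_cases hd : d ∈ T.edges
  · rw [T.shiftOn_apply_of_mem_edges hd, T.shiftOn_apply_of_mem_edges hd]
    rfl
  · obtain ⟨e, rfl⟩ : ∃ e : T.Gen, e.1 = d := ⟨⟨d, hd⟩, rfl⟩
    by_cases hes : e ∈ s
    · rw [T.shiftOn_apply_of_mem hes, T.shiftOn_apply_of_mem hes, shift_apply_self,
        shift_apply_self, holonomy_gauge c g (T.collapse_path_isWalk _), hc, OrientedGraph.gauge]
      change c (collapseVertex Y (K.src e)) * _ * _ * _ * _ * (c (collapseVertex Y (K.src e)) *
        _ * _) = c (collapseVertex Y (K.src e)) * _ * _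
      group
    · rw [T.shiftOn_apply_of_notMem hes, T.shiftOn_apply_of_notMem hes]
      rfl

end Shift

section Logical

variable (φ₂ φ₁ : K.GhostPi1 Y →* G)

open scoped Classical in
theorem noncommProd_ket (s : Finset T.Gen)
    (comm : (s : Set T.Gen).Pairwise
      (Function.onFun Commute fun e => T.xShift φ₂ φ₁ e * T.zLogical φ₁ e)) (g : E → G) :
    s.noncommProd (fun e => T.xShift φ₂ φ₁ e * T.zLogical φ₁ e) comm (ket g) =
      if ∀ e ∈ s, holonomy g (T.loop e).word = φ₁ (T.gen e) then ket (T.shiftOn φ₂ φ₁ s g)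
      else 0 := by
  induction s using Finset.induction_on generalizing g with
  | empty => simp [shiftOn_empty]
  | insert a s ha ih =>
    rw [Finset.noncommProd_insert_of_notMem' _ _ _ _ ha, Module.End.mul_apply,
      xShift_mul_zLogical_ket]
    simp only [Finset.forall_mem_insert]
    by_cases h : holonomy g (T.loop a).word = φ₁ (T.gen a)
    · rw [if_pos h, ih, T.shiftOn_shift (by simpa using ha), Finset.coe_insert]
      simp only [h, true_and]
      refine if_congr (forall₂_congr fun e he => ?_) rfl rfl
      rw [T.holonomy_loop_shift φ₂ φ₁ (ne_of_mem_of_not_mem he ha).symm]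
    · rw [if_neg h, map_zero, if_neg fun h' => h h'.1]

variable [Finite E]

open scoped Classical in
theorem xLogical_ket (g : E → G) : T.xLogical φ₂ φ₁ (ket g) =
    if HasHolonomy φ₁ g then ket (T.shiftOn φ₂ φ₁ Set.univ g) else 0 := by
  rw [T.hasHolonomy_iff, xLogical]
  refine (T.noncommProd_ket φ₂ φ₁ _ _ g).trans ?_
  simp

theorem commutesWithChecks_xLogical : K.CommutesWithChecks Y (T.xLogical φ₂ φ₁) := by
  classical
  refine ⟨fun v hv h => end_ext_ket fun g => ?_, fun f => end_ext_ket fun g => ?_⟩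
  · have hc : (Pi.mulSingle (some ⟨v, hv⟩) h : Option {v : V // v ∉ Y} → G) none = 1 := by
      simp
    rw [Module.End.mul_apply, Module.End.mul_apply, xCheck_eq hv, ketOp_ket, xLogical_ket,
      xLogical_ket, T.shiftOn_gauge hc, hasHolonomy_gauge_iff hc]
    split <;> simp
  · rw [Module.End.mul_apply, Module.End.mul_apply, zCheck, indicatorOp_ket, xLogical_ket]
    by_cases hg : HasHolonomy φ₁ g
    · rw [if_pos hg, if_pos (T.flat_of_hasHolonomy hg f), indicatorOp_ket,
        if_pos (T.flat_of_hasHolonomy (T.hasHolonomy_shiftOn_univ hg) f), xLogical_ket, if_pos hg]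
    -- Without holonomy `φ₁` the logical operator kills `|g⟩`, whether or not the plaquette check
    -- keeps it.
    · rw [if_neg hg, map_zero]
      split
      · rw [xLogical_ket, if_neg hg]
      · rw [map_zero]

variable [Finite G]

/-- The simultaneous shift is a bijection between the two supports, with inverse the shift for the
exchanged homomorphisms. -/
theorem xLogical_codeword_self :
    T.xLogical φ₂ φ₁ (K.codeword Y φ₁) = K.codeword Y φ₂ := by
  classical
  have := Fintype.ofFinite (E → G)
  rw [codeword_eq_sum, codeword_eq_sum, map_sum]
  refine Finset.sum_nbij' (T.shiftOn φ₂ φ₁ Set.univ) (T.shiftOn φ₁ φ₂ Set.univ) ?_ ?_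
    (fun g _ => T.shiftOn_univ_shiftOn_univ g) (fun g _ => T.shiftOn_univ_shiftOn_univ g) ?_
  · simpa using fun g => T.hasHolonomy_shiftOn_univ
  · simpa using fun g => T.hasHolonomy_shiftOn_univ
  · intro g hg
    rw [xLogical_ket, if_pos (Finset.mem_filter.1 hg).2]

theorem xLogical_codeword_of_ne {φ : K.GhostPi1 Y →* G} (h : φ ≠ φ₁) :
    T.xLogical φ₂ φ₁ (K.codeword Y φ) = 0 := by
  classical
  have := Fintype.ofFinite (E → G)
  rw [codeword_eq_sum, map_sum]
  refine Finset.sum_eq_zero fun g hg => ?_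
  rw [xLogical_ket, if_neg fun h' => h ((Finset.mem_filter.1 hg).2.unique h')]

-- Identifying the restrictions with the matrix units of `codewordBasis` gives linear independence
-- and spanning at once.
open scoped Classical in
theorem restrict_xLogical_eq [Finite {v : V // v ∉ Y}] [Fintype (K.GhostPi1 Y →* G)] :
    (fun p : (K.GhostPi1 Y →* G) × (K.GhostPi1 Y →* G) =>
      (T.xLogical p.1 p.2).restrict (T.commutesWithChecks_xLogical p.1 p.2).isLogical) =
    T.codewordBasis.linearMap T.codewordBasis := by
  ext1 p
  refine T.codewordBasis.ext fun φ => Subtype.ext ?_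
  rw [Module.Basis.linearMap_apply_apply]
  change T.xLogical p.1 p.2 (T.codewordBasis φ : State E G) = _
  rw [coe_codewordBasis]
  split
  · subst_vars
    rw [xLogical_codeword_self, coe_codewordBasis]
  · rw [T.xLogical_codeword_of_ne _ _ (by tauto)]
    rfl

end Logical

end RootedForest

end TwoComplex

end QuantumDouble

open QuantumDouble QuantumDouble.TwoComplex in
theorem mainTheorem7 {V E F G : Type*} [Finite E] [Group G] [Finite G]
    (K : TwoComplex V E F) (Y : Set V) (hY : Y.Nonempty)
    (hconn : ∀ v : V, ∃ y ∈ Y, ∃ w : EdgeWord E, K.IsWalk v w y) :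
    Nonempty (K.RootedForest Y) ∧
    ∀ T : K.RootedForest Y,
      -- the presentation of the fundamental group
      (∃ Ψ : PresentedGroup (Set.range T.relator) ≃* K.GhostPi1 Y,
        ∀ e : T.Gen, Ψ (PresentedGroup.of e) = T.gen e) ∧
      -- the labelling of the codespace by homomorphisms
      (LinearIndependent ℂ (fun φ : K.GhostPi1 Y →* G => K.codeword Y φ) ∧
        Submodule.span ℂ (Set.range fun φ : K.GhostPi1 Y →* G => K.codeword Y φ) =
          K.codespace Y G) ∧
      -- the `Z`-logicals
      (∃ hZ : ∀ (φ : K.GhostPi1 Y →* G) (e : T.Gen), K.CommutesWithChecks Y (T.zLogical φ e),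
        ∀ B : Module.End ℂ (K.codespace Y G),
          B ∈ Algebra.adjoin ℂ (Set.range fun p : (K.GhostPi1 Y →* G) × T.Gen =>
              (T.zLogical p.1 p.2).restrict (hZ p.1 p.2).isLogical) ↔
            ∃ (D : Module.End ℂ (State E G)) (hD : K.IsLogical Y D),
              IsZType D ∧ D.restrict hD = B) ∧
      -- all logicals
      (∃ hX : ∀ φ₂ φ₁ : K.GhostPi1 Y →* G, K.CommutesWithChecks Y (T.xLogical φ₂ φ₁),
        (∀ φ₂ φ₁ : K.GhostPi1 Y →* G,
          T.xLogical φ₂ φ₁ (K.codeword Y φ₁) = K.codeword Y φ₂ ∧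
          ∀ φ : K.GhostPi1 Y →* G, φ ≠ φ₁ → T.xLogical φ₂ φ₁ (K.codeword Y φ) = 0) ∧
        LinearIndependent ℂ (fun p : (K.GhostPi1 Y →* G) × (K.GhostPi1 Y →* G) =>
          (T.xLogical p.1 p.2).restrict (hX p.1 p.2).isLogical) ∧
        Submodule.span ℂ (Set.range fun p : (K.GhostPi1 Y →* G) × (K.GhostPi1 Y →* G) =>
          (T.xLogical p.1 p.2).restrict (hX p.1 p.2).isLogical) = ⊤) := by
  have := finite_nonghost hconn
  obtain ⟨D⟩ := exists_descent hconn
  refine ⟨⟨D.forest⟩, fun T => ⟨⟨T.presentation, T.presentation_of⟩,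
    ⟨T.linearIndependent_codeword, T.span_codeword⟩,
    ⟨T.commutesWithChecks_zLogical, T.mem_adjoin_zLogical_iff⟩,
    fun φ₂ φ₁ => T.commutesWithChecks_xLogical φ₂ φ₁,
    fun φ₂ φ₁ => ⟨T.xLogical_codeword_self φ₂ φ₁, fun φ h => T.xLogical_codeword_of_ne φ₂ φ₁ h⟩,
    ?_⟩⟩
  classical
  have := T.finite_hom (G := G)
  have := Fintype.ofFinite (K.GhostPi1 Y →* G)
  rw [T.restrict_xLogical_eq]
  exact ⟨Module.Basis.linearIndependent _, Module.Basis.span_eq _⟩
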